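/- Let $H$ be a complex Hilbert space and $Q\in N_\kappa(H)$, i.e. $Q$ is an $L(H)$-valued function, meromorphic on $\mathbb C\setminus\mathbb R$, with $Q(\bar z)^*=Q(z)$ on its domain of holomorphy $D(Q)\subseteq\mathbb C\setminus\mathbb R$, whose kernel $\frac{Q(z)-Q(w)^*}{z-\bar w}$, $z,w\in D(Q)\cap\mathbb C^+$, has $\kappa$ negative squares. Let $(K,[\cdot,\cdot])$ be a Pontryagin space, $\Gamma:H\to K$ a bounded operator with adjoint $\Gamma^+$ (that is, $(h,\Gamma^+k)=[\Gamma h,k]$), and suppose that $Q$ is represented by $(K,A,\Gamma)$ in one of the following two ways. (I) $A$ is a self-adjoint linear relation in $K$, $z_0\in D(Q)\cap\mathbb C^+$, $D(Q)\subseteq\rho(A)$, $$Q(z)=Q(z_0)^*+(z-\bar z_0)\Gamma^+\bigl(I+(z-z_0)(A-z)^{-1}\bigr)\Gamma,\qquad z\in D(Q),$$ and the representation is minimal: $K=\mathrm{cls}\{(I+(z-z_0)(A-z)^{-1})\Gamma h:\ z\in\rho(A),\ h\in H\}$. (II) $A$ is a bounded self-adjoint operator in $K$, $D(Q)\subseteq\rho(A)$,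 $Q(z)=\Gamma^+(A-z)^{-1}\Gamma$ for $z\in D(Q)$, and the representation is minimal: $K=\mathrm{cls}\{(A-z)^{-1}\Gamma h:\ z\in\rho(A),\ h\in H\}$. Let $\alpha\in\mathbb R$ be a generalized pole of $Q$ not of positive type, i.e. $A$ has an eigenvector $x\neq0$ at $\alpha$ with $[x,x]\le0$. Then there are maximal ones among the closed subspaces $K_0\subseteq\ker(A-\alpha)$ with $[x,x]>0$ for all $0\ne x\in K_0$, and for every such maximal $K_0$ the following holds. (i) There are $r\ge0$ and bounded $[\cdot,\cdot]$-orthogonal projections $E_0,\dots,E_{r+1}$ with $E_iE_j=0$ $(i\ne j)$, $\sum_iE_i=I$, $E_0K=K_0$, reducing $A$ (i.e. $(x,y)\in A$ implies $(E_ix,E_iy)\in A$), so that with $K_i:=E_iK$ $$K=K_0[+]K_1[+]\cdots[+]K_r[+]K_{r+1}.$$ Each $K_i$ is a Pontryagin space of some index $\kappa_i$, where $\kappa_0=0$ and $\sum_{i=1}^{r+1}\kappa_i=\kappa$. Every eigenvector of $A$ at $\alpha$ that is orthogonal to $K_0$ is nonpositive. Let $A_i:=A\cap(K_i\times K_i)$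 be the part of $A$ in $K_i$, and $\Gamma_i:=E_i\Gamma$. Then $A_i$ and $\Gamma_i$ are closely connected in $K_i$ for $0\le i\le r+1$ (the minimality condition in (I), respectively (II), holds for $(K_i,A_i,\Gamma_i)$). For $1\le i\le r$, $A_i$ is an operator whose only eigenvalue is $\alpha$. Every Jordan chain of $A$ at $\alpha$ in $K_{r+1}$ is degenerate, i.e. $[\cdot,\cdot]$ degenerates on its span. (ii) For $1\le i\le r$ there are $l_i\ge1$ and $h_i\in H$ such that $x^i_k=(A_i-\alpha)^{l_i-1-k}\Gamma_ih_i$, $k=0,\dots,l_i-1$, is a nondegenerate Jordan chain of $A$ at $\alpha$ that is maximal (it cannot be prolonged beyond $x^i_{l_i-1}=\Gamma_ih_i$), and $K_i$ is its linear span. (iii) There are functions $Q_i\in N_{\kappa_i}(H)$ with $D(Q)\subseteq D(Q_i)$, $0\le i\le r+1$, such that $Q=Q_0+Q_1+\cdots+Q_{r+1}$ on $D(Q)$, and $Q_i$ is minimally represented by $(K_i,A_i,\Gamma_i)$ in the same way (I), respectively (II), as $Q$ is by $(K,A,\Gamma)$. In case (II) this means $Q_i(z)=\Gamma_i^+(A_i-zE_i)^{-1}\Gamma_i$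 for $0\le i\le r+1$. In case (I), for $0\le i\le r$, $A_i$ is a bounded operator and in addition $Q_i(z)=\widetilde\Gamma_i^+(A_i-zE_i)^{-1}\widetilde\Gamma_i$ with $\widetilde\Gamma_i:=(A_i-z_0)\Gamma_i$, again a minimal representation. -/

import Mathlib

open scoped ComplexConjugate

noncomputable section

namespace GenNev

/-! ### Generalized Nevanlinna functions -/

section Nevanlinna

variable {H : Type*} [NormedAddCommGroup H] [InnerProductSpace ℂ H] [CompleteSpace H]

/-- The domain `D(Q)`: the non-real points of holomorphy of `Q`. -/
def domain (Q : ℂ → H →L[ℂ] H) : Set ℂ := {z | z.im ≠ 0 ∧ AnalyticAt ℂ Q z}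

/-- The Nevanlinna kernel `(Q(z) - Q(w)*) / (z - conj w)`. -/
def kernel (Q : ℂ → H →L[ℂ] H) (z w : ℂ) : H →L[ℂ] H :=
  (z - conj w)⁻¹ • (Q z - ContinuousLinearMap.adjoint (Q w))

/-- The matrix `(N_Q(z_i, z_j) h_i, h_j)`. The scalar product `(·,·)` of the literature is linear in
its first entry, whereas `inner` is linear in its second one. -/
def kernelMatrix (Q : ℂ → H →L[ℂ] H) {n : ℕ} (z : Fin n → ℂ) (h : Fin n → H) :
    Matrix (Fin n) (Fin n) ℂ :=
  Matrix.of fun i j => inner ℂ (h j) (kernel Q (z i) (z j) (h i))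

theorem kernelMatrix_isHermitian (Q : ℂ → H →L[ℂ] H) {n : ℕ} (z : Fin n → ℂ) (h : Fin n → H) :
    (kernelMatrix Q z h).IsHermitian := by
  ext i j
  simp only [Matrix.conjTranspose_apply, kernelMatrix, Matrix.of_apply, kernel,
    ContinuousLinearMap.smul_apply, ContinuousLinearMap.sub_apply, inner_smul_right,
    inner_sub_right, ContinuousLinearMap.adjoint_inner_right, RCLike.star_def, map_mul, map_sub,
    map_inv₀, inner_conj_symm, Complex.conj_conj]
  rw [← neg_sub (z i) (conj (z j)), inv_neg]
  ring

/-- The number of negative eigenvalues (with multiplicity) of the matrix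
`(N_Q(z_i, z_j) h_i, h_j)`. -/
def negCount (Q : ℂ → H →L[ℂ] H) {n : ℕ} (z : Fin n → ℂ) (h : Fin n → H) : ℕ :=
  Nat.card {i : Fin n // (kernelMatrix_isHermitian Q z h).eigenvalues i < 0}

/-- The class `N_κ(H)`. -/
structure IsGeneralizedNevanlinna (κ : ℕ) (Q : ℂ → H →L[ℂ] H) : Prop where
  meromorphic : MeromorphicOn Q {z : ℂ | z.im ≠ 0}
  symmetric : ∀ z ∈ domain Q, ContinuousLinearMap.adjoint (Q (conj z)) = Q z
  neg_le : ∀ (n : ℕ) (z : Fin n → ℂ) (h : Fin n → H),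
    (∀ i, z i ∈ domain Q ∧ 0 < (z i).im) → negCount Q z h ≤ κ
  neg_eq : ∃ (n : ℕ) (z : Fin n → ℂ) (h : Fin n → H),
    (∀ i, z i ∈ domain Q ∧ 0 < (z i).im) ∧ negCount Q z h = κ

end Nevanlinna

/-! ### Pontryagin spaces

The space is given as a Hilbert space `V` with an indefinite form `[x, y] = ⟪x, G y⟫`, the Hilbert
space norm being one of the (equivalent) norms that define the topology of `(V, [·,·])`. -/

section Spaces

variable {V : Type*} [NormedAddCommGroup V] [InnerProductSpace ℂ V]

/-- The form `[x, y]` with Gram operator `G` (linear in `y`). -/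
def form (G : V →L[ℂ] V) (x y : V) : ℂ := inner ℂ x (G y)

/-- `(V, [·,·])` is a Pontryagin space of index `κ`: it is an orthogonal direct sum of a subspace `P`
which is a Hilbert space for `[·,·]` (its norm `[x, x]^(1/2)` being equivalent to the given one) and
a negative definite subspace `N` of dimension `κ`. -/
structure IsPontryagin (G : V →L[ℂ] V) (κ : ℕ) : Prop where
  hermitian : ∀ x y, form G y x = conj (form G x y)
  fundamental : ∃ P N : Submodule ℂ V, IsCompl P N ∧ (∀ x ∈ P, ∀ y ∈ N, form G x y = 0) ∧
    IsClosed (P : Set V) ∧ (∃ c : ℝ, 0 < c ∧ ∀ x ∈ P, c * ‖x‖ ^ 2 ≤ (form G x x).re) ∧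
    (∀ x ∈ N, x ≠ 0 → (form G x x).re < 0) ∧
    FiniteDimensional ℂ N ∧ Module.finrank ℂ N = κ

/-- The form does not degenerate on the subspace `M`. -/
def Nondegenerate (G : V →L[ℂ] V) (M : Submodule ℂ V) : Prop :=
  ∀ v ∈ M, (∀ w ∈ M, form G v w = 0) → v = 0

/-! ### Linear relations, as subspaces of `V × V` -/

/-- `A` equals its adjoint `{(x, y) | [v, x] = [u, y] for all (u, v) ∈ A}`. -/
def IsSelfAdjointRel (G : V →L[ℂ] V) (A : Submodule ℂ (V × V)) : Prop :=
  ∀ x y, (x, y) ∈ A ↔ ∀ u v, (u, v) ∈ A → form G v x = form G u y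

/-- The relation `(A - z)⁻¹` is (the graph of) the bounded operator `R`. -/
def IsResolventAt (A : Submodule ℂ (V × V)) (z : ℂ) (R : V →L[ℂ] V) : Prop :=
  ∀ x y, (x, y) ∈ A ↔ R (y - z • x) = x

/-- The resolvent set `ρ(A)`. -/
def rho (A : Submodule ℂ (V × V)) : Set ℂ := {z | ∃ R, IsResolventAt A z R}

open scoped Classical in
/-- The operator `(A - z)⁻¹`, meaningful for `z ∈ ρ(A)`. -/
def res (A : Submodule ℂ (V × V)) (z : ℂ) : V →L[ℂ] V :=
  if h : ∃ R, IsResolventAt A z R then h.choose else 0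

/-- `μ` is an eigenvalue of `A`. -/
def IsEigenvalue (A : Submodule ℂ (V × V)) (μ : ℂ) : Prop := ∃ x, x ≠ 0 ∧ (x, μ • x) ∈ A

/-- `x 0, …, x (l - 1)` is a Jordan chain of `A` at `μ`:
`(A - μ) x 0 = 0`, `(A - μ) x (k + 1) = x k`, `x 0 ≠ 0`. -/
structure IsJordanChain (A : Submodule ℂ (V × V)) (μ : ℂ) {l : ℕ} (x : Fin l → V) : Prop where
  pos : 0 < l
  first : ∀ k : Fin l, k.val = 0 → x k ≠ 0 ∧ (x k, μ • x k) ∈ A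
  next : ∀ j k : Fin l, k.val = j.val + 1 → (x k, μ • x k + x j) ∈ A

/-- `M` is a closed subspace consisting of `0` and positive eigenvectors of `A` at `α`. -/
structure IsPositiveEigenspace (G : V →L[ℂ] V) (A : Submodule ℂ (V × V)) (α : ℝ)
    (M : Submodule ℂ V) : Prop where
  closed : IsClosed (M : Set V)
  eigen : ∀ x ∈ M, (x, (α : ℂ) • x) ∈ A
  pos : ∀ x ∈ M, x ≠ 0 → 0 < (form G x x).re

/-- `M` is a maximal closed subspace consisting of `0` and positive eigenvectors of `A` at `α`. -/
def IsMaximalPositiveEigenspace (G : V →L[ℂ] V) (A : Submodule ℂ (V × V)) (α : ℝ)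
    (M : Submodule ℂ V) : Prop :=
  IsPositiveEigenspace G A α M ∧ ∀ M', IsPositiveEigenspace G A α M' → M ≤ M' → M' = M

/-- `α` is an eigenvalue of the representing relation (that is, a generalized pole of the represented
function) with a nonpositive eigenvector. -/
def IsPoleNotOfPositiveType (G : V →L[ℂ] V) (A : Submodule ℂ (V × V)) (α : ℝ) : Prop :=
  ∃ x, x ≠ 0 ∧ (x, (α : ℂ) • x) ∈ A ∧ (form G x x).re ≤ 0

end Spaces

/-! ### Operator representations -/

section Representations

variable {H : Type*} [NormedAddCommGroup H] [InnerProductSpace ℂ H] [CompleteSpace H]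
variable {V : Type*} [NormedAddCommGroup V] [InnerProductSpace ℂ V] [CompleteSpace V]

/-- `Γ⁺ : V → H`, that is `(h, Γ⁺ k) = [Γ h, k]`. -/
def plus (G : V →L[ℂ] V) (Γ : H →L[ℂ] V) : V →L[ℂ] H := (ContinuousLinearMap.adjoint Γ).comp G

theorem inner_plus (G : V →L[ℂ] V) (Γ : H →L[ℂ] V) (h : H) (k : V) :
    inner ℂ h (plus G Γ k) = form G (Γ h) k := by
  simp [plus, form, ContinuousLinearMap.adjoint_inner_right]

/-- `Γ_z = (I + (z - z₀)(A - z)⁻¹) Γ`. -/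
def gammaField (A : Submodule ℂ (V × V)) (Γ : H →L[ℂ] V) (z₀ z : ℂ) : H →L[ℂ] V :=
  (ContinuousLinearMap.id ℂ V + (z - z₀) • res A z).comp Γ

/-- The triplet `(V, A, Γ)`, with `V` a Pontryagin space of index `κ` and `A` a self-adjoint
relation, is a minimal representation
`Q(z) = Q(z₀)* + (z - conj z₀) Γ⁺ (I + (z - z₀)(A - z)⁻¹) Γ`, `z ∈ D(Q)`. -/
structure IsMinimalRepresentation (κ : ℕ) (Q : ℂ → H →L[ℂ] H) (G : V →L[ℂ] V)
    (A : Submodule ℂ (V × V)) (Γ : H →L[ℂ] V) (z₀ : ℂ) : Prop where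
  pontryagin : IsPontryagin G κ
  selfAdjoint : IsSelfAdjointRel G A
  upper : 0 < z₀.im
  base : z₀ ∈ domain Q
  domain_subset : domain Q ⊆ rho A
  formula : ∀ z ∈ domain Q, Q z = ContinuousLinearMap.adjoint (Q z₀) +
    (z - conj z₀) • (plus G Γ).comp (gammaField A Γ z₀ z)
  minimal : (Submodule.span ℂ {v : V | ∃ z ∈ rho A, ∃ h : H,
    v = gammaField A Γ z₀ z h}).topologicalClosure = ⊤

/-- The triplet `(V, A, Γ)`, with `V` a Pontryagin space of index `κ` and `A` a bounded self-adjoint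
operator (identified with its graph), is a minimal representation
`Q(z) = Γ⁺ (A - z)⁻¹ Γ`, `z ∈ D(Q)`. -/
structure IsMinimalOperatorRepresentation (κ : ℕ) (Q : ℂ → H →L[ℂ] H) (G : V →L[ℂ] V)
    (A : Submodule ℂ (V × V)) (Γ : H →L[ℂ] V) : Prop where
  pontryagin : IsPontryagin G κ
  selfAdjoint : IsSelfAdjointRel G A
  bounded : ∃ T : V →L[ℂ] V, A = (T : V →ₗ[ℂ] V).graph
  domain_subset : domain Q ⊆ rho A
  formula : ∀ z ∈ domain Q, Q z = (plus G Γ).comp ((res A z).comp Γ)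
  minimal : (Submodule.span ℂ {v : V | ∃ z ∈ rho A, ∃ h : H,
    v = res A z (Γ h)}).topologicalClosure = ⊤

end Representations

/-! ### Orthogonal projections and parts in their ranges -/

section Projections

variable {H : Type*} [NormedAddCommGroup H] [InnerProductSpace ℂ H] [CompleteSpace H]
variable {K : Type*} [NormedAddCommGroup K] [InnerProductSpace ℂ K] [CompleteSpace K]

/-- A bounded projection which is orthogonal with respect to `[·,·]`. -/
structure OrthProj (G : K →L[ℂ] K) where
  op : K →L[ℂ] K
  idem : ∀ x, op (op x) = op x
  symm : ∀ x y, form G (op x) y = form G x (op y)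

namespace OrthProj

variable {G : K →L[ℂ] K} (E : OrthProj G)

/-- The subspace `E K`. -/
def space : Submodule ℂ K := LinearMap.range (E.op : K →ₗ[ℂ] K)

theorem mem_space_iff (x : K) : x ∈ E.space ↔ E.op x = x := by
  constructor
  · rintro ⟨y, rfl⟩
    exact E.idem y
  · intro h
    exact ⟨x, h⟩

theorem isClosed_space : IsClosed (E.space : Set K) := by
  have h : (E.space : Set K) = {x | E.op x = x} := by
    ext x
    exact E.mem_space_iff x
  rw [h]
  exact isClosed_eq E.op.continuous continuous_id

instance : CompleteSpace E.space := E.isClosed_space.completeSpace_coe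

/-- The Gram operator on `E K` of the restriction of `[·,·]`. -/
def gram : E.space →L[ℂ] E.space :=
  (ContinuousLinearMap.adjoint E.space.subtypeL).comp (G.comp E.space.subtypeL)

theorem form_gram (x y : E.space) : form E.gram x y = form G (x : K) (y : K) := by
  simp [form, gram, ContinuousLinearMap.adjoint_inner_right]

/-- The part of the relation `A` in `E K`. -/
def part (A : Submodule ℂ (K × K)) : Submodule ℂ (E.space × E.space) :=
  A.comap (LinearMap.prodMap E.space.subtype E.space.subtype)

/-- `E Γ : H → E K`. -/
def comp (Γ : H →L[ℂ] K) : H →L[ℂ] E.space :=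
  (E.op.comp Γ).codRestrict E.space fun h => ⟨Γ h, rfl⟩

end OrthProj

/-- The vectors `x_k = (T - α)^(l - 1 - k) v`, `k = 0, …, l - 1`. -/
def chainFrom {V : Type*} [NormedAddCommGroup V] [InnerProductSpace ℂ V] (T : V →L[ℂ] V) (α : ℝ)
    (l : ℕ) (v : V) (k : Fin l) : V :=
  ((T - (α : ℂ) • ContinuousLinearMap.id ℂ V) ^ (l - 1 - k.val)) v

/-- The subspace `E K` is `A`-invariant, `A` has there the single eigenvalue `α`, and it is spanned by
a nondegenerate Jordan chain `x_k = (A - α)^(l - 1 - k) E Γ h`, which is maximal (no `y` satisfies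
`(A - α) y = x_(l - 1)`). -/
def IsJordanPart (G : K →L[ℂ] K) (A : Submodule ℂ (K × K)) (Γ : H →L[ℂ] K) (α : ℝ)
    (E : OrthProj G) : Prop :=
  (∀ μ : ℂ, IsEigenvalue (E.part A) μ ↔ μ = (α : ℂ)) ∧
  ∃ (T : E.space →L[ℂ] E.space) (l : ℕ) (h : H),
    E.part A = (T : E.space →ₗ[ℂ] E.space).graph ∧
    IsJordanChain (E.part A) (α : ℂ) (chainFrom T α l (E.comp Γ h)) ∧
    Nondegenerate E.gram (Submodule.span ℂ (Set.range (chainFrom T α l (E.comp Γ h)))) ∧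
    Submodule.span ℂ (Set.range (chainFrom T α l (E.comp Γ h))) = ⊤ ∧
    ¬ ∃ y : K, (y, (α : ℂ) • y + (E.comp Γ h : K)) ∈ A

/-- The orthogonal decomposition `K = K_0 [+] K_1 [+] … [+] K_r [+] K_(r+1)` with `K_i = E_i K`
a Pontryagin space of index `k i`, reducing the relation `A`. The indices `1, …, r` are the
`i.succ.castSucc` with `i : Fin r`. -/
structure IsJordanDecomposition (G : K →L[ℂ] K) (A : Submodule ℂ (K × K)) (Γ : H →L[ℂ] K) (α : ℝ)
    (κ : ℕ) (K₀ : Submodule ℂ K) {r : ℕ} (E : Fin (r + 2) → OrthProj G) (k : Fin (r + 2) → ℕ) :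
    Prop where
  orthogonal : ∀ i j, i ≠ j → (E i).op.comp (E j).op = 0
  sum_eq : ∑ i, (E i).op = ContinuousLinearMap.id ℂ K
  pontryagin : ∀ i, IsPontryagin (E i).gram (k i)
  index_zero : k 0 = 0
  index_sum : ∑ j : Fin (r + 1), k j.succ = κ
  reduces : ∀ i x y, (x, y) ∈ A → ((E i).op x, (E i).op y) ∈ A
  space_zero : (E 0).space = K₀
  nonpos : ∀ x, (x, (α : ℂ) • x) ∈ A → (∀ y ∈ K₀, form G y x = 0) → (form G x x).re ≤ 0
  jordan : ∀ i : Fin r, IsJordanPart G A Γ α (E i.succ.castSucc)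
  degenerate : ∀ (l : ℕ) (x : Fin l → (E (Fin.last (r + 1))).space),
    IsJordanChain ((E (Fin.last (r + 1))).part A) (α : ℂ) x →
    ¬ Nondegenerate (E (Fin.last (r + 1))).gram (Submodule.span ℂ (Set.range x))

end Projections

end GenNev

end

open GenNev
open scoped ComplexConjugate

/-! The negative index of the space and that of the function agree. In a minimal representation the
Nevanlinna kernel is the Gram kernel of the vectors `γ z h`, so matrices of the kernel cannot have
more negative eigenvalues than the space has negative squares. Conversely, the vectors with `z` in
`D(Q)` span a dense subspace, and being a negative family is an open condition. The kernel only sees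
the upper half plane. The commuting isometries `I + (z - conj z)(A - z)⁻¹` map `γ (conj z) h` to `γ
z h` and leave the closed upper span invariant, so a finite product of them carries a negative
family there (`isGeneralizedNevanlinna_of_minimal`). Hence `κ' = κ`, and the same theorem later puts
every summand into its class.

The geometry rests on Gårding's inequality: the form is uniformly positive up to a finite rank term.
It makes closed positive subspaces uniformly positive, hence ranges of orthogonal projections, and
it passes to subspaces, so every `E K` is a Pontryagin space. The indices of an orthogonal
decomposition add up (`IsPontryagin.index_sum`).

A projection `E` reduces `A` as soon as `A` contains the graph of an everywhere defined operator on
`E K`. This applies to a maximal positive eigenspace `K₀`. By maximality all eigenvectors at `α` in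
its orthogonal complement are nonpositive. If a Jordan chain there is nondegenerate, its span splits
off as a reducing subspace, and it contains a negative vector because its eigenvector is nonpositive
but not isotropic in the span. Each splitting therefore lowers the number of available negative
squares, and the process stops with only degenerate chains left (`exists_jordan_splitting`). By
minimality some `E Γ h` is not annihilated by the top nonzero power of the nilpotent operator on
such a span, and such a vector is cyclic; this gives the chain ending in `E Γ h`
(`exists_isJordanPart`).

On every part except the last, `A - α` is nilpotent, so the corresponding function is explicit and
holomorphic off `α`. The last function is the difference between `Q` and these, and its
representation formula follows from orthogonality of the decomposition. -/

namespace GenNev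

/-! ### Sesquilinear algebra of the form -/

section FormAlgebra

variable {V : Type*} [NormedAddCommGroup V] [InnerProductSpace ℂ V] (G : V →L[ℂ] V)

theorem form_add_left (x y z : V) : form G (x + y) z = form G x z + form G y z := by
  simp [form]

theorem form_add_right (x y z : V) : form G x (y + z) = form G x y + form G x z := by
  simp [form]

theorem form_sub_left (x y z : V) : form G (x - y) z = form G x z - form G y z := by
  simp [form]

theorem form_sub_right (x y z : V) : form G x (y - z) = form G x y - form G x z := by
  simp [form]

theorem form_smul_left (c : ℂ) (x y : V) : form G (c • x) y = conj c * form G x y := by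
  simp [form, mul_comm]

theorem form_smul_right (c : ℂ) (x y : V) : form G x (c • y) = c * form G x y := by
  simp [form]

@[simp] theorem form_zero_left (y : V) : form G 0 y = 0 := by simp [form]

@[simp] theorem form_zero_right (x : V) : form G x 0 = 0 := by simp [form]

theorem form_sum_left {ι : Type*} (s : Finset ι) (f : ι → V) (y : V) :
    form G (∑ i ∈ s, f i) y = ∑ i ∈ s, form G (f i) y := by
  simp [form]

theorem form_sum_right {ι : Type*} (s : Finset ι) (f : ι → V) (x : V) :
    form G x (∑ i ∈ s, f i) = ∑ i ∈ s, form G x (f i) := by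
  simp [form]

theorem continuous_form : Continuous fun p : V × V => form G p.1 p.2 :=
  continuous_fst.inner (G.continuous.comp continuous_snd)

theorem form_self_re_smul (c : ℂ) (x : V) :
    (form G (c • x) (c • x)).re = ‖c‖ ^ 2 * (form G x x).re := by
  rw [form_smul_left, form_smul_right, ← mul_assoc, Complex.conj_mul', ← Complex.ofReal_pow,
    Complex.re_ofReal_mul]

theorem abs_form_self_re_le (x : V) : |(form G x x).re| ≤ ‖G‖ * ‖x‖ ^ 2 := by
  calc |(form G x x).re| ≤ ‖form G x x‖ := Complex.abs_re_le_norm _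
    _ ≤ ‖x‖ * ‖G x‖ := norm_inner_le_norm _ _
    _ ≤ ‖x‖ * (‖G‖ * ‖x‖) := by gcongr; exact G.le_opNorm x
    _ = _ := by ring

variable {G}

/-- A hermitian form that takes a nonpositive value at `x` and does not vanish at `(x, y)` takes a
negative value on `y + ℂ x`. -/
theorem exists_form_neg (hG : ∀ x y, form G y x = conj (form G x y)) {x y : V}
    (hx : (form G x x).re ≤ 0) (hxy : form G x y ≠ 0) :
    ∃ t : ℂ, (form G (y + t • x) (y + t • x)).re < 0 := by
  set b := form G x y with hb
  have hb0 : 0 < ‖b‖ ^ 2 := by positivity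
  obtain ⟨s, hs⟩ : ∃ s : ℝ, (form G y y).re - 2 * s * ‖b‖ ^ 2 < 0 := by
    -- With this `s` the left-hand side equals `-1`.
    refine ⟨((form G y y).re + 1) / (2 * ‖b‖ ^ 2), ?_⟩
    field_simp
    linarith
  -- For `t = -s b` both cross terms equal `-s ‖b‖²`, and the quadratic term is nonpositive by `hx`.
  refine ⟨-(s : ℂ) * b, lt_of_le_of_lt ?_ hs⟩
  have e : form G (y + (-(s : ℂ) * b) • x) (y + (-(s : ℂ) * b) • x)
      = form G y y - ((2 * s * ‖b‖ ^ 2 : ℝ) : ℂ)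
        + form G ((-(s : ℂ) * b) • x) ((-(s : ℂ) * b) • x) := by
    have h1 : form G y x = conj b := hG x y
    have h2 : conj b * b = ((‖b‖ ^ 2 : ℝ) : ℂ) := by rw [Complex.conj_mul']; push_cast; ring
    rw [form_add_left, form_add_right, form_add_right, form_smul_right (x := y), h1,
      form_smul_left (y := y), ← hb]
    simp only [map_mul, map_neg, Complex.conj_ofReal]
    push_cast at h2 ⊢
    linear_combination (-2 * (s : ℂ)) * h2
  rw [e, Complex.add_re, Complex.sub_re, Complex.ofReal_re, form_self_re_smul]
  have : ‖-(s : ℂ) * b‖ ^ 2 * (form G x x).re ≤ 0 :=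
    mul_nonpos_of_nonneg_of_nonpos (by positivity) hx
  linarith

end FormAlgebra

/-! ### Negative families -/

section NegativeFamily

variable {V : Type*} [NormedAddCommGroup V] [InnerProductSpace ℂ V] {G : V →L[ℂ] V}
variable {ι : Type*} [Fintype ι]

/-- Every nontrivial linear combination of the vectors `v i` is negative. -/
def IsNegativeFamily (G : V →L[ℂ] V) (v : ι → V) : Prop :=
  ∀ c : ι → ℂ, c ≠ 0 → (form G (∑ i, c i • v i) (∑ i, c i • v i)).re < 0

theorem IsNegativeFamily.linearIndependent {v : ι → V} (h : IsNegativeFamily G v) :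
    LinearIndependent ℂ v := by
  rw [Fintype.linearIndependent_iff]
  intro c hc
  by_contra hne
  have := h c (fun h0 => hne fun i => by simp [h0])
  simp [hc] at this

theorem IsNegativeFamily.form_neg_of_mem_span {v : ι → V} (h : IsNegativeFamily G v) {x : V}
    (hx : x ∈ Submodule.span ℂ (Set.range v)) (hx0 : x ≠ 0) : (form G x x).re < 0 := by
  obtain ⟨c, rfl⟩ := (Submodule.mem_span_range_iff_exists_fun ℂ).1 hx
  exact h c (fun h0 => hx0 (by simp [h0]))

theorem isNegativeFamily_of_basis {N : Submodule ℂ V} (hN : ∀ x ∈ N, x ≠ 0 → (form G x x).re < 0)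
    (b : Module.Basis ι ℂ N) : IsNegativeFamily G (fun i => (b i : V)) := by
  intro c hc
  have e : ∑ i, c i • (b i : V) = ((∑ i, c i • b i : N) : V) := by simp
  rw [e]
  refine hN _ (Submodule.coe_mem _) fun h0 => hc ?_
  have h1 : ∑ i, c i • b i = 0 := by exact_mod_cast h0
  funext i
  exact Fintype.linearIndependent_iff.1 b.linearIndependent c h1 i

/-- Mapping a negative family by a linear map that preserves the form. -/
theorem IsNegativeFamily.map {W : Type*} [NormedAddCommGroup W] [InnerProductSpace ℂ W]
    {G' : W →L[ℂ] W} {v : ι → V} (h : IsNegativeFamily G v) (f : V →ₗ[ℂ] W)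
    (hf : ∀ x, form G' (f x) (f x) = form G x x) : IsNegativeFamily G' (fun i => f (v i)) := by
  intro c hc
  have e : ∑ i, c i • f (v i) = f (∑ i, c i • v i) := by simp
  rw [e, hf]
  exact h c hc

/-- Being a negative family is an open condition. -/
theorem IsNegativeFamily.eventually {v : ι → V} (h : IsNegativeFamily G v) :
    ∀ᶠ w in nhds v, IsNegativeFamily G w := by
  -- By homogeneity it is enough to test coefficients of norm one. These form a compact set, so
  -- pointwise openness becomes uniform.
  have hK : IsCompact (Metric.sphere (0 : ι → ℂ) 1) := isCompact_sphere _ _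
  have hcont : Continuous fun p : (ι → V) × (ι → ℂ) =>
      (form G (∑ i, p.2 i • p.1 i) (∑ i, p.2 i • p.1 i)).re := by
    have h1 : Continuous fun p : (ι → V) × (ι → ℂ) => ∑ i, p.2 i • p.1 i := by fun_prop
    exact Complex.continuous_re.comp ((continuous_form G).comp (h1.prodMk h1))
  have := hK.eventually_forall_of_forall_eventually (x₀ := v)
    (P := fun w c => (form G (∑ i, c i • w i) (∑ i, c i • w i)).re < 0) (by
      intro c hc
      have hc0 : c ≠ 0 := by
        rintro rfl
        simp at hc
      exact hcont.continuousAt.eventually_lt continuousAt_const (h c hc0))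
  filter_upwards [this] with w hw c hc
  have hn : ‖c‖ ≠ 0 := by simpa using hc
  have h1 := hw ((‖c‖⁻¹ : ℂ) • c) (by simp [norm_smul, hn])
  have e : ∑ i, ((‖c‖⁻¹ : ℂ) • c) i • w i = (‖c‖⁻¹ : ℂ) • ∑ i, c i • w i := by
    simp [Finset.smul_sum, smul_smul]
  rw [e, form_self_re_smul] at h1
  by_contra hneg
  push Not at hneg
  have : 0 ≤ ‖(‖c‖⁻¹ : ℂ)‖ ^ 2 * (form G (∑ i, c i • w i) (∑ i, c i • w i)).re := by positivity
  linarith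

/-- A negative family in the closure of `S` can be moved into `S`. -/
theorem IsNegativeFamily.exists_of_mem_closure {v : ι → V} (h : IsNegativeFamily G v) {S : Set V}
    (hv : ∀ i, v i ∈ closure S) : ∃ w : ι → V, (∀ i, w i ∈ S) ∧ IsNegativeFamily G w := by
  have h1 : v ∈ closure (Set.pi Set.univ fun _ : ι => S) := by
    rw [closure_pi_set]
    exact fun i _ => hv i
  obtain ⟨w, hw1, hw2⟩ := (mem_closure_iff_frequently.1 h1).and_eventually h.eventually |>.exists
  exact ⟨w, fun i => hw1 i trivial, hw2⟩

/-- A negative family, extended by a negative vector orthogonal to it. -/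
theorem IsNegativeFamily.cons {n : ℕ} {v : Fin n → V} (h : IsNegativeFamily G v)
    (hG : ∀ x y, form G y x = conj (form G x y)) {x : V} (hx : (form G x x).re < 0)
    (hxv : ∀ i, form G x (v i) = 0) : IsNegativeFamily G (Fin.cons x v : Fin (n + 1) → V) := by
  intro c hc
  rw [Fin.sum_univ_succ]
  simp only [Fin.cons_zero, Fin.cons_succ]
  set y := ∑ i : Fin n, c i.succ • v i with hy
  have h1 : form G x y = 0 := by
    rw [hy, form_sum_right]
    exact Finset.sum_eq_zero fun i _ => by rw [form_smul_right, hxv, mul_zero]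
  have h2 : form G y x = 0 := by rw [hG x y, h1, map_zero]
  have e : (form G (c 0 • x + y) (c 0 • x + y)).re = ‖c 0‖ ^ 2 * (form G x x).re
      + (form G y y).re := by
    rw [form_add_left, form_add_right, form_add_right, form_smul_left (y := y), h1,
      form_smul_right (x := y), h2, Complex.add_re, Complex.add_re, form_self_re_smul]
    simp
  rw [e]
  by_cases h0 : (fun i : Fin n => c i.succ) = 0
  · have hc0 : c 0 ≠ 0 := by
      intro hc0
      apply hc
      funext i
      refine Fin.cases hc0 (fun j => congrFun h0 j) i
    have hy0 : y = 0 := by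
      rw [hy]
      exact Finset.sum_eq_zero fun i _ => by rw [congrFun h0 i]; simp
    rw [hy0]
    have : 0 < ‖c 0‖ ^ 2 := by positivity
    simp only [form_zero_left, Complex.zero_re, add_zero]
    exact mul_neg_of_pos_of_neg this hx
  · have := h _ h0
    have h4 : ‖c 0‖ ^ 2 * (form G x x).re ≤ 0 :=
      mul_nonpos_of_nonneg_of_nonpos (by positivity) hx.le
    linarith

end NegativeFamily

/-! ### Gårding's inequality -/

section Garding

variable {V : Type*} [NormedAddCommGroup V] [InnerProductSpace ℂ V] {G : V →L[ℂ] V}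

/-- The form is positive up to the finite rank perturbation `C ‖π x‖²`. -/
def IsGarding (G : V →L[ℂ] V) {n : ℕ} (π : V →L[ℂ] (Fin n → ℂ)) (c C : ℝ) : Prop :=
  0 < c ∧ 0 ≤ C ∧ ∀ x, c * ‖x‖ ^ 2 ≤ (form G x x).re + C * ‖π x‖ ^ 2

/-- Here `π` is the projection `x = p + n ↦ n` along `P`, in coordinates of `N`. From `‖x‖² ≤ 2‖p‖²
+ 2‖n‖²` one gets `(c/2)‖x‖² ≤ [p,p] + c‖n‖² ≤ [x,x] + (c + ‖G‖)‖n‖²`. -/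
theorem IsPontryagin.exists_isGarding [CompleteSpace V] {κ : ℕ} (h : IsPontryagin G κ) :
    ∃ (π : V →L[ℂ] (Fin κ → ℂ)) (c C : ℝ), IsGarding G π c C := by
  obtain ⟨P, N, hPN, horth, hP, ⟨c, hc, hcP⟩, hN, hfin, hrank⟩ := h.fundamental
  have hNc : IsClosed (N : Set V) := N.closed_of_finiteDimensional
  let σ : V →L[ℂ] N := Submodule.projectionOntoL N P (Submodule.IsCompl.isTopCompl_of_isClosed hPN.symm hNc hP)
  have hdec : ∀ x, x - (σ x : V) ∈ P := by
    intro x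
    have h1 : σ (x - (σ x : V)) = 0 := by
      rw [map_sub, sub_eq_zero]
      exact (Submodule.projectionOnto_apply_left hPN.symm (σ x)).symm
    exact (Submodule.projectionOnto_apply_eq_zero_iff hPN.symm).1 h1
  let e : N ≃L[ℂ] (Fin κ → ℂ) := ContinuousLinearEquiv.ofFinrankEq (by simp [hrank])
  refine ⟨(e : N →L[ℂ] (Fin κ → ℂ)).comp σ, c / 2,
    (c + ‖G‖) * ‖(e.symm : (Fin κ → ℂ) →L[ℂ] N)‖ ^ 2, by positivity, by positivity, fun x => ?_⟩
  set n : V := (σ x : V) with hn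
  set p : V := x - n with hp
  have hxp : x = p + n := by simp [hp]
  have hpn : form G p n = 0 := horth p (hdec x) n (Submodule.coe_mem _)
  have hnp : form G n p = 0 := by rw [h.hermitian p n, hpn, map_zero]
  have e1 : (form G x x).re = (form G p p).re + (form G n n).re := by
    rw [hxp, form_add_left, form_add_right, form_add_right, hpn, hnp]
    simp
  have h1 : c * ‖p‖ ^ 2 ≤ (form G p p).re := hcP p (hdec x)
  have h2 : -(‖G‖ * ‖n‖ ^ 2) ≤ (form G n n).re := (abs_le.1 (abs_form_self_re_le G n)).1
  have h3 : ‖x‖ ^ 2 ≤ 2 * ‖p‖ ^ 2 + 2 * ‖n‖ ^ 2 := by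
    have : ‖x‖ ≤ ‖p‖ + ‖n‖ := by
      conv_lhs => rw [hxp]
      exact norm_add_le _ _
    have h0 := norm_nonneg x
    nlinarith [sq_nonneg (‖p‖ - ‖n‖)]
  have h4 : ‖n‖ ≤ ‖(e.symm : (Fin κ → ℂ) →L[ℂ] N)‖ * ‖e (σ x)‖ := by
    have := (e.symm : (Fin κ → ℂ) →L[ℂ] N).le_opNorm (e (σ x))
    simpa using this
  have h5 : ‖n‖ ^ 2 ≤ ‖(e.symm : (Fin κ → ℂ) →L[ℂ] N)‖ ^ 2 * ‖e (σ x)‖ ^ 2 := by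
    rw [← mul_pow]
    gcongr
  have h6 : (c + ‖G‖) * ‖n‖ ^ 2 ≤
      (c + ‖G‖) * (‖(e.symm : (Fin κ → ℂ) →L[ℂ] N)‖ ^ 2 * ‖e (σ x)‖ ^ 2) := by gcongr
  change _ ≤ _ + _ * ‖e (σ x)‖ ^ 2
  have h7 : c / 2 * ‖x‖ ^ 2 ≤ c / 2 * (2 * ‖p‖ ^ 2 + 2 * ‖n‖ ^ 2) := by gcongr
  rw [e1]
  linarith

theorem IsPontryagin.exists_isNegativeFamily {κ : ℕ} (h : IsPontryagin G κ) :
    ∃ v : Fin κ → V, IsNegativeFamily G v := by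
  obtain ⟨P, N, hPN, horth, hP, ⟨c, hc, hcP⟩, hN, hfin, hrank⟩ := h.fundamental
  exact ⟨_, isNegativeFamily_of_basis hN (Module.finBasisOfFinrankEq ℂ N hrank)⟩

theorem IsPontryagin.eq_zero_of_forall_form {κ : ℕ} (h : IsPontryagin G κ) {x : V}
    (hx : ∀ y, form G x y = 0) : x = 0 := by
  obtain ⟨P, N, hPN, horth, hP, ⟨c, hc, hcP⟩, hN, hfin, hrank⟩ := h.fundamental
  obtain ⟨p, hp, n, hn, rfl⟩ := Submodule.mem_sup.1
    (show x ∈ P ⊔ N from hPN.sup_eq_top ▸ Submodule.mem_top)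
  have h1 : form G p p = 0 := by
    have := hx p
    rwa [form_add_left, h.hermitian p n, horth p hp n hn, map_zero, add_zero] at this
  have h2 : form G n n = 0 := by
    have := hx n
    rwa [form_add_left, horth p hp n hn, zero_add] at this
  have h3 := hcP p hp
  rw [h1, Complex.zero_re] at h3
  have hp0 : p = 0 := by
    by_contra hne
    have : 0 < c * ‖p‖ ^ 2 := by positivity
    linarith
  have hn0 : n = 0 := by
    by_contra hne
    have := hN n hn hne
    rw [h2] at this
    simp at this
  simp [hp0, hn0]

theorem IsPontryagin.eq_of_forall_form {κ : ℕ} (h : IsPontryagin G κ) {x x' : V}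
    (hx : ∀ y, form G x y = form G x' y) : x = x' :=
  sub_eq_zero.1 (h.eq_zero_of_forall_form fun y => by rw [form_sub_left, hx, sub_self])

theorem IsPontryagin.eq_of_forall_form' {κ : ℕ} (h : IsPontryagin G κ) {x x' : V}
    (hx : ∀ y, form G y x = form G y x') : x = x' :=
  h.eq_of_forall_form fun y => by rw [h.hermitian y x, h.hermitian y x', hx]

variable {n : ℕ} {π : V →L[ℂ] (Fin n → ℂ)} {c C : ℝ}

/-- On the kernel of `π` the form is nonnegative, so `π` is injective on the span of a negative
family. -/
theorem IsGarding.card_le (h : IsGarding G π c C) {ι : Type*} [Fintype ι] {v : ι → V}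
    (hv : IsNegativeFamily G v) : Fintype.card ι ≤ n := by
  let f : (ι → ℂ) →ₗ[ℂ] (Fin n → ℂ) := (π : V →ₗ[ℂ] _) ∘ₗ Fintype.linearCombination ℂ v
  have hf : Function.Injective f := by
    rw [← LinearMap.ker_eq_bot, LinearMap.ker_eq_bot']
    intro a ha
    by_contra hne
    have h1 := hv a hne
    have h2 := h.2.2 (∑ i, a i • v i)
    have h3 : π (∑ i, a i • v i) = 0 := by
      simpa [f, Fintype.linearCombination_apply] using ha
    rw [h3] at h2
    have h4 : 0 ≤ c * ‖∑ i, a i • v i‖ ^ 2 := mul_nonneg h.1.le (by positivity)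
    simp at h2
    linarith
  simpa using LinearMap.finrank_le_finrank_of_injective hf

theorem IsPontryagin.card_le [CompleteSpace V] {κ : ℕ} (h : IsPontryagin G κ) {ι : Type*}
    [Fintype ι] {v : ι → V} (hv : IsNegativeFamily G v) : Fintype.card ι ≤ κ := by
  obtain ⟨π, c, C, hπ⟩ := h.exists_isGarding
  exact hπ.card_le hv

/-- A closed positive definite subspace is uniformly positive. -/
theorem IsGarding.exists_uniform [CompleteSpace V] (h : IsGarding G π c C) {M : Submodule ℂ V}
    (hM : IsClosed (M : Set V)) (hpos : ∀ x ∈ M, x ≠ 0 → 0 < (form G x x).re) :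
    ∃ d : ℝ, 0 < d ∧ ∀ x ∈ M, d * ‖x‖ ^ 2 ≤ (form G x x).re := by
  obtain ⟨hc, hC, hin⟩ := h
  have hnonneg : ∀ x ∈ M, 0 ≤ (form G x x).re := by
    intro x hx
    by_cases h0 : x = 0
    · simp [h0]
    · exact (hpos x hx h0).le
  by_contra hcon
  push Not at hcon
  have hseq : ∀ k : ℕ, ∃ x ∈ M, ‖x‖ = 1 ∧ (form G x x).re < 1 / ((k : ℝ) + 1) := by
    intro k
    obtain ⟨x, hx, hlt⟩ := hcon (1 / ((k : ℝ) + 1)) (by positivity)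
    have hx0 : x ≠ 0 := by
      rintro rfl
      simp at hlt
    have hn : 0 < ‖x‖ := norm_pos_iff.2 hx0
    refine ⟨(‖x‖⁻¹ : ℂ) • x, M.smul_mem _ hx, ?_, ?_⟩
    · rw [norm_smul]
      simp [hn.ne']
    · rw [form_self_re_smul]
      have : ‖(‖x‖⁻¹ : ℂ)‖ = ‖x‖⁻¹ := by simp
      rw [this, inv_pow, inv_mul_lt_iff₀ (by positivity), mul_comm]
      exact hlt
  -- Unit vectors with form values tending to zero. Once `π` converges along a subsequence,
  -- Gårding's inequality makes that subsequence Cauchy, and its limit contradicts positivity.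
  choose x hxM hx1 hxlt using hseq
  obtain ⟨a, -, φ, hφ, hlim⟩ := tendsto_subseq_of_bounded
    (s := Metric.closedBall (0 : Fin n → ℂ) ‖π‖) Metric.isBounded_closedBall
    (x := fun k => π (x k)) (fun k => by
      simpa [hx1 k] using π.le_opNorm (x k))
  have hcauchy : CauchySeq (x ∘ φ) := by
    have hlimC : CauchySeq ((fun k => π (x k)) ∘ φ) := hlim.cauchySeq
    rw [Metric.cauchySeq_iff] at hlimC ⊢
    intro ε hε
    -- The two thresholds share `c ε²` equally: the term `C ‖π (y - z)‖²` stays below one half, and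
    -- form values below `c ε² / 8` contribute the other half through the parallelogram identity.
    -- Writing `C + 1` avoids a division by zero.
    obtain ⟨N₁, hN₁⟩ := hlimC (Real.sqrt (c * ε ^ 2 / (2 * (C + 1))))
      (Real.sqrt_pos.2 (by positivity))
    obtain ⟨N₂, hN₂⟩ := exists_nat_gt (8 / (c * ε ^ 2))
    refine ⟨max N₁ N₂, fun k hk l hl => ?_⟩
    have hsmall : ∀ k ≥ max N₁ N₂, (form G (x (φ k)) (x (φ k))).re < c * ε ^ 2 / 8 := by
      intro k hk
      have h1 : (N₂ : ℝ) ≤ (φ k : ℝ) := by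
        exact_mod_cast le_trans (le_trans (le_max_right _ _) hk) (hφ.id_le k)
      refine (hxlt (φ k)).trans ?_
      have h2 : 8 / (c * ε ^ 2) < (φ k : ℝ) + 1 := by linarith
      rw [div_lt_iff₀ (by positivity)] at h2
      rw [div_lt_div_iff₀ (by positivity) (by norm_num)]
      linarith
    set y := x (φ k) with hy
    set z := x (φ l) with hz
    have hπ : ‖π (y - z)‖ ^ 2 < c * ε ^ 2 / (2 * (C + 1)) := by
      have := hN₁ k (le_trans (le_max_left _ _) hk) l (le_trans (le_max_left _ _) hl)
      rw [dist_eq_norm, Real.lt_sqrt (norm_nonneg _)] at this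
      rw [map_sub]
      exact this
    have hpar : (form G (y - z) (y - z)).re + (form G (y + z) (y + z)).re
        = 2 * (form G y y).re + 2 * (form G z z).re := by
      simp only [form_add_left, form_add_right, form_sub_left, form_sub_right, Complex.add_re,
        Complex.sub_re]
      ring
    have h1 := hnonneg (y + z) (M.add_mem (hxM _) (hxM _))
    have h2 := hin (y - z)
    have h3 := hsmall k hk
    have h4 := hsmall l hl
    have h5 : C * ‖π (y - z)‖ ^ 2 ≤ c * ε ^ 2 / 2 := by
      have e : c * ε ^ 2 / 2 = (C + 1) * (c * ε ^ 2 / (2 * (C + 1))) := by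
        field_simp
      rw [e]
      have : C * ‖π (y - z)‖ ^ 2 ≤ (C + 1) * ‖π (y - z)‖ ^ 2 := by gcongr; linarith
      refine this.trans ?_
      gcongr
    have h6 : c * ‖y - z‖ ^ 2 < c * ε ^ 2 := by linarith
    have h7 : ‖y - z‖ ^ 2 < ε ^ 2 := lt_of_mul_lt_mul_left h6 hc.le
    change dist y z < ε
    rw [dist_eq_norm]
    exact lt_of_pow_lt_pow_left₀ 2 hε.le h7
  obtain ⟨u, hu⟩ := cauchySeq_tendsto_of_complete hcauchy
  have huM : u ∈ M := hM.mem_of_tendsto hu (Filter.Eventually.of_forall fun k => hxM _)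
  have hu1 : ‖u‖ = 1 := tendsto_nhds_unique hu.norm (by simp [hx1])
  have hform : Filter.Tendsto (fun k => (form G (x (φ k)) (x (φ k))).re) Filter.atTop
      (nhds (form G u u).re) :=
    (Complex.continuous_re.tendsto _).comp (((continuous_form G).tendsto (u, u)).comp
      (hu.prodMk_nhds hu))
  have hle : (form G u u).re ≤ 0 := by
    refine le_of_tendsto_of_tendsto hform
      (tendsto_one_div_add_atTop_nhds_zero_nat.comp hφ.tendsto_atTop)
      (Filter.Eventually.of_forall fun k => (hxlt (φ k)).le)
  have hu0 : u ≠ 0 := by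
    rintro rfl
    simp at hu1
  exact absurd (hpos u huM hu0) (not_lt.2 hle)

end Garding

/-! ### Orthogonal projections -/

section Projection

variable {K : Type*} [NormedAddCommGroup K] [InnerProductSpace ℂ K] {G : K →L[ℂ] K}

namespace OrthProj

theorem op_mem (E : OrthProj G) (x : K) : E.op x ∈ E.space := ⟨x, rfl⟩

theorem op_eq (E : OrthProj G) {x : K} (hx : x ∈ E.space) : E.op x = x := by
  obtain ⟨y, rfl⟩ := hx
  exact E.idem y

/-- A projection onto `M` whose kernel is orthogonal to `M`. -/
def ofForm (hG : ∀ x y, form G y x = conj (form G x y)) (M : Submodule ℂ K) (T : K →L[ℂ] K)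
    (hmem : ∀ x, T x ∈ M) (hid : ∀ x ∈ M, T x = x)
    (hform : ∀ m ∈ M, ∀ x, form G m (T x) = form G m x) : OrthProj G where
  op := T
  idem x := hid _ (hmem x)
  symm x y := by
    rw [← hform _ (hmem x), hG (T y) x, ← hform _ (hmem y), ← hG]

theorem space_ofForm (hG : ∀ x y, form G y x = conj (form G x y)) (M : Submodule ℂ K)
    (T : K →L[ℂ] K) (hmem : ∀ x, T x ∈ M) (hid : ∀ x ∈ M, T x = x)
    (hform : ∀ m ∈ M, ∀ x, form G m (T x) = form G m x) :
    (ofForm hG M T hmem hid hform).space = M := by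
  ext x
  constructor
  · rintro ⟨y, rfl⟩
    exact hmem y
  · intro hx
    exact ⟨x, hid x hx⟩

/-- The difference of two projections `E ≤ F`. -/
def sub (F E : OrthProj G) (h₁ : ∀ x, F.op (E.op x) = E.op x) (h₂ : ∀ x, E.op (F.op x) = E.op x) :
    OrthProj G where
  op := F.op - E.op
  idem x := by simp [h₁, h₂, F.idem, E.idem]
  symm x y := by simp [form_sub_left, form_sub_right, F.symm, E.symm]

/-- The identity. -/
def one : OrthProj G where
  op := ContinuousLinearMap.id ℂ K
  idem _ := rfl
  symm _ _ := rfl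

end OrthProj

variable [CompleteSpace K]

/-- The compression of the Gram operator to a complete subspace. -/
noncomputable def compression (G : K →L[ℂ] K) (M : Submodule ℂ K) [CompleteSpace M] : M →L[ℂ] M :=
  (ContinuousLinearMap.adjoint M.subtypeL).comp (G.comp M.subtypeL)

theorem inner_compression (M : Submodule ℂ K) [CompleteSpace M] (x y : M) :
    inner ℂ x (compression G M y) = form G (x : K) y := by
  simp [compression, form, ContinuousLinearMap.adjoint_inner_right]

/-- With `J` the inclusion of `M`, the projection is `J (J* G J)⁻¹ J* G`: pairing its value at `x`
with `m` in `M` gives `⟪m, J* G x⟫ = [m, x]`. -/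
theorem exists_orthProj_of_isUnit (hG : ∀ x y, form G y x = conj (form G x y))
    (M : Submodule ℂ K) [CompleteSpace M] (hu : IsUnit (compression G M)) :
    ∃ E : OrthProj G, E.space = M := by
  obtain ⟨u, hu⟩ := hu
  let S : K →L[ℂ] M :=
    (↑u⁻¹ : M →L[ℂ] M).comp ((ContinuousLinearMap.adjoint M.subtypeL).comp G)
  have hS : ∀ x, compression G M (S x) = ContinuousLinearMap.adjoint M.subtypeL (G x) := by
    intro x
    rw [← hu]
    change ((u : M →L[ℂ] M) * (↑u⁻¹ : M →L[ℂ] M)) (ContinuousLinearMap.adjoint M.subtypeL (G x)) = _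
    rw [u.mul_inv]
    rfl
  have hS' : ∀ x : M, S x = x := by
    intro x
    change (↑u⁻¹ : M →L[ℂ] M) (compression G M x) = x
    rw [← hu]
    change ((↑u⁻¹ : M →L[ℂ] M) * (u : M →L[ℂ] M)) x = x
    rw [u.inv_mul]
    rfl
  refine ⟨OrthProj.ofForm hG M (M.subtypeL.comp S) (fun x => (S x).2)
    (fun x hx => congrArg Subtype.val (hS' ⟨x, hx⟩)) (fun m hm x => ?_),
    OrthProj.space_ofForm _ _ _ _ _ _⟩
  change form G ((⟨m, hm⟩ : M) : K) (S x : K) = _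
  rw [← inner_compression, hS, ContinuousLinearMap.adjoint_inner_right]
  rfl

/-- Uniform positivity is coercivity of the compression, which is then invertible by Lax–Milgram. -/
theorem exists_orthProj_of_uniform (hG : ∀ x y, form G y x = conj (form G x y))
    {M : Submodule ℂ K} (hM : IsClosed (M : Set K)) {d : ℝ} (hd : 0 < d)
    (hpos : ∀ x ∈ M, d * ‖x‖ ^ 2 ≤ (form G x x).re) : ∃ E : OrthProj G, E.space = M := by
  have : CompleteSpace M := hM.completeSpace_coe
  refine exists_orthProj_of_isUnit hG M
    (ContinuousLinearMap.isUnit_of_forall_le_norm_inner_map _ (c := ⟨d, hd.le⟩) hd fun x => ?_)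
  rw [norm_inner_symm, inner_compression]
  refine le_trans ?_ (Complex.re_le_norm _)
  have := hpos x x.2
  rw [mul_comm]
  exact this

theorem exists_orthProj_of_nondegenerate (hG : ∀ x y, form G y x = conj (form G x y))
    {M : Submodule ℂ K} [FiniteDimensional ℂ M] (hM : Nondegenerate G M) :
    ∃ E : OrthProj G, E.space = M := by
  have : CompleteSpace M := FiniteDimensional.complete ℂ M
  refine exists_orthProj_of_isUnit hG M ?_
  have hinj : Function.Injective (compression G M : M →ₗ[ℂ] M) := by
    rw [← LinearMap.ker_eq_bot, LinearMap.ker_eq_bot']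
    intro x hx
    have hx' : compression G M x = 0 := hx
    refine Subtype.ext (hM x x.2 fun w hw => ?_)
    have := inner_compression (G := G) M ⟨w, hw⟩ x
    rw [hx', inner_zero_right] at this
    rw [hG w x, ← this, map_zero]
  rw [ContinuousLinearMap.isUnit_iff_bijective]
  exact ⟨hinj, LinearMap.injective_iff_surjective.1 hinj⟩

end Projection

/-! ### Pontryagin spaces from Gårding's inequality -/

section Pontryagin

variable {V : Type*} [NormedAddCommGroup V] [InnerProductSpace ℂ V] {G : V →L[ℂ] V}

theorem IsNegativeFamily.nondegenerate_span {ι : Type*} [Fintype ι] {v : ι → V}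
    (h : IsNegativeFamily G v) : Nondegenerate G (Submodule.span ℂ (Set.range v)) := by
  intro x hx h0
  by_contra hne
  have := h.form_neg_of_mem_span hx hne
  rw [h0 x hx] at this
  simp at this

/-- The closed subspace of vectors orthogonal to `M`. -/
def orthogonal (G : V →L[ℂ] V) (M : Submodule ℂ V) : Submodule ℂ V where
  carrier := {x | ∀ m ∈ M, form G m x = 0}
  add_mem' hx hy m hm := by rw [form_add_right, hx m hm, hy m hm, add_zero]
  zero_mem' m _ := form_zero_right G m
  smul_mem' c x hx m hm := by rw [form_smul_right, hx m hm, mul_zero]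

theorem isClosed_orthogonal (M : Submodule ℂ V) : IsClosed (orthogonal G M : Set V) := by
  have : (orthogonal G M : Set V) = ⋂ m ∈ M, {x | form G m x = 0} := by
    ext x
    simp [orthogonal]
  rw [this]
  exact isClosed_biInter fun m _ => isClosed_eq
    ((continuous_form G).comp (continuous_const.prodMk continuous_id)) continuous_const

variable [CompleteSpace V]

/-- Let `N` be spanned by a negative family of maximal size, which exists because Gårding's
inequality bounds the size. Its orthogonal complement `P` is nonnegative by maximality. A neutral
vector of `P` must be orthogonal to `P`, since otherwise `exists_form_neg` yields a negative vector,
and it then vanishes by nondegeneracy. So `P` is positive definite, hence uniformly positive. -/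
theorem IsGarding.exists_isPontryagin {n : ℕ} {π : V →L[ℂ] (Fin n → ℂ)} {c C : ℝ}
    (h : IsGarding G π c C) (hG : ∀ x y, form G y x = conj (form G x y))
    (hnd : ∀ x, (∀ y, form G x y = 0) → x = 0) : ∃ k, IsPontryagin G k := by
  classical
  let S : ℕ → Prop := fun m => ∃ v : Fin m → V, IsNegativeFamily G v
  have hS0 : S 0 := ⟨Fin.elim0, fun c hc => absurd (Subsingleton.elim c 0) hc⟩
  have hSb : ∀ m, S m → m ≤ n := fun m ⟨v, hv⟩ => by simpa using h.card_le hv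
  set k := Nat.findGreatest S n with hk
  obtain ⟨v, hv⟩ : S k := Nat.findGreatest_spec (Nat.zero_le n) hS0
  have hmax : ¬ S (k + 1) := fun hs => by
    have := Nat.le_findGreatest (hSb _ hs) hs
    omega
  set N := Submodule.span ℂ (Set.range v) with hN
  have hNfin : FiniteDimensional ℂ N := FiniteDimensional.span_of_finite ℂ (Set.finite_range v)
  obtain ⟨F, hF⟩ : ∃ F : OrthProj G, F.space = N :=
    exists_orthProj_of_nondegenerate hG hv.nondegenerate_span
  set P := orthogonal G N with hP
  have hPnonneg : ∀ x ∈ P, 0 ≤ (form G x x).re := by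
    intro x hx
    by_contra hneg
    push Not at hneg
    refine hmax ⟨_, hv.cons hG hneg fun i => ?_⟩
    rw [hG (v i) x, hx _ (Submodule.subset_span ⟨i, rfl⟩), map_zero]
  have hdec : ∀ x, x - F.op x ∈ P := by
    intro x m hm
    rw [← hF] at hm
    rw [form_sub_right, ← F.symm, F.op_eq hm, sub_self]
  have hFm : ∀ x, F.op x ∈ N := fun x => hF ▸ F.op_mem x
  have hPpos : ∀ x ∈ P, x ≠ 0 → 0 < (form G x x).re := by
    intro x hx hx0
    refine lt_of_le_of_ne (hPnonneg x hx) fun h0 => hx0 (hnd x fun y => ?_)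
    have h1 : form G x (F.op y) = 0 := by rw [hG (F.op y) x, hx _ (hFm y), map_zero]
    have h2 : form G x (y - F.op y) = 0 := by
      by_contra hne
      obtain ⟨t, ht⟩ := exists_form_neg hG h0.symm.le hne
      exact absurd (hPnonneg _ (P.add_mem (hdec y) (P.smul_mem t hx))) (not_le.2 ht)
    rw [form_sub_right, h1, sub_zero] at h2
    exact h2
  refine ⟨k, hG, P, N, ⟨?_, ?_⟩, ?_, isClosed_orthogonal N,
    h.exists_uniform (isClosed_orthogonal N) hPpos,
    fun x hx hx0 => hv.form_neg_of_mem_span hx hx0, hNfin, ?_⟩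
  · rw [Submodule.disjoint_def]
    intro x hxP hxN
    by_contra hne
    exact absurd (hv.form_neg_of_mem_span hxN hne) (not_lt.2 (hPnonneg x hxP))
  · rw [codisjoint_iff, eq_top_iff]
    intro x _
    exact Submodule.mem_sup.2 ⟨_, hdec x, _, hFm x, sub_add_cancel _ _⟩
  · intro x hx y hy
    rw [hG y x, hx y hy, map_zero]
  · rw [hN, finrank_span_eq_card hv.linearIndependent, Fintype.card_fin]

theorem IsPontryagin.index_unique {k m : ℕ} (h : IsPontryagin G k) (h' : IsPontryagin G m) :
    k = m := by
  obtain ⟨v, hv⟩ := h.exists_isNegativeFamily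
  obtain ⟨w, hw⟩ := h'.exists_isNegativeFamily
  have h1 := h'.card_le hv
  have h2 := h.card_le hw
  simp at h1 h2
  omega

theorem OrthProj.gram_hermitian (E : OrthProj G) (hG : ∀ x y, form G y x = conj (form G x y))
    (x y : E.space) : form E.gram y x = conj (form E.gram x y) := by
  rw [E.form_gram, E.form_gram, hG]

/-- Gårding's inequality restricts to `E K` at once, whereas a fundamental decomposition of the
whole space need not be compatible with `E`. The form does not degenerate on `E K` because `[x, E y]
= [x, y]` for `x` in `E K`. -/
theorem OrthProj.exists_isPontryagin (E : OrthProj G) {κ : ℕ} (h : IsPontryagin G κ) :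
    ∃ k, IsPontryagin E.gram k := by
  obtain ⟨π, c, C, hc, hC, hπ⟩ := h.exists_isGarding
  refine IsGarding.exists_isPontryagin (π := π.comp E.space.subtypeL) (c := c) (C := C)
    ⟨hc, hC, fun x => ?_⟩ (E.gram_hermitian h.hermitian) fun x hx => Subtype.ext ?_
  · rw [E.form_gram]
    exact hπ x
  · refine h.eq_zero_of_forall_form fun y => ?_
    have := hx ⟨E.op y, E.op_mem y⟩
    rw [E.form_gram, ← E.symm, E.op_eq x.2] at this
    exact this

/-- The negative index of an orthogonal sum. -/
theorem IsPontryagin.index_sum {κ : ℕ} (h : IsPontryagin G κ) {ι : Type*} [Fintype ι]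
    (E : ι → OrthProj G) (hsum : ∀ x, ∑ i, (E i).op x = x)
    (horth : ∀ i j, i ≠ j → ∀ x, (E i).op ((E j).op x) = 0) {k : ι → ℕ}
    (hk : ∀ i, IsPontryagin (E i).gram (k i)) : ∑ i, k i = κ := by
  classical
  have hform : ∀ x y, form G x y = ∑ i, form G ((E i).op x) ((E i).op y) := by
    intro x y
    conv_lhs => rw [← hsum x]
    rw [form_sum_left]
    exact Finset.sum_congr rfl fun i _ => by rw [← (E i).symm, (E i).idem]
  apply le_antisymm
  -- Maximal negative families of the parts together form a negative family of the whole space.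
  · choose v hv using fun i => (hk i).exists_isNegativeFamily
    have hneg : IsNegativeFamily G (fun p : Σ i, Fin (k i) => (v p.1 p.2 : V)) := by
      intro c hc
      set x : V := ∑ p : Σ i, Fin (k i), c p • (v p.1 p.2 : V) with hx
      have hEx : ∀ i, (E i).op x = ((∑ j, c ⟨i, j⟩ • v i j : (E i).space) : V) := by
        intro i
        rw [hx, Fintype.sum_sigma, map_sum, Finset.sum_eq_single i]
        · rw [map_sum]
          push_cast
          refine Finset.sum_congr rfl fun j _ => ?_
          rw [map_smul, (E i).op_eq (v i j).2]
        · intro b _ hb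
          rw [map_sum]
          refine Finset.sum_eq_zero fun j _ => ?_
          rw [map_smul, ← (E b).op_eq (v b j).2, horth i b hb.symm, smul_zero]
        · intro hi
          exact absurd (Finset.mem_univ i) hi
      have hle : ∀ i, (form G ((E i).op x) ((E i).op x)).re ≤ 0 := by
        intro i
        rw [hEx, ← (E i).form_gram]
        by_cases h0 : (fun j => c ⟨i, j⟩) = 0
        · simp [fun j => congrFun h0 j]
        · exact (hv i _ h0).le
      obtain ⟨⟨i, j⟩, hij⟩ : ∃ p, c p ≠ 0 := by
        by_contra hcon
        push Not at hcon
        exact hc (funext hcon)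
      rw [hform, Complex.re_sum]
      refine Finset.sum_neg' (fun i _ => hle i) ⟨i, Finset.mem_univ i, ?_⟩
      rw [hEx, ← (E i).form_gram]
      exact hv i _ fun h0 => hij (congrFun h0 j)
    simpa using h.card_le hneg
  -- A combination annihilated by all `π i ∘ E i` has nonnegative form in every part, hence in
  -- total, so these maps are jointly injective on the span of a negative family.
  · obtain ⟨v, hv⟩ := h.exists_isNegativeFamily
    choose π c C hπ using fun i => (hk i).exists_isGarding
    let f : (Fin κ → ℂ) →ₗ[ℂ] (∀ i, Fin (k i) → ℂ) :=
      LinearMap.pi fun i => ((π i : (E i).space →ₗ[ℂ] _) ∘ₗ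
        ((E i).op : V →ₗ[ℂ] V).codRestrict (E i).space (E i).op_mem) ∘ₗ
          Fintype.linearCombination ℂ v
    have hf : Function.Injective f := by
      rw [← LinearMap.ker_eq_bot, LinearMap.ker_eq_bot']
      intro a ha
      by_contra hne
      refine absurd (hv a hne) (not_lt.2 ?_)
      rw [hform, Complex.re_sum]
      refine Finset.sum_nonneg fun i _ => ?_
      have h1 : π i ⟨(E i).op (∑ j, a j • v j), (E i).op_mem _⟩ = 0 := congrFun ha i
      have h2 := (hπ i).2.2 ⟨(E i).op (∑ j, a j • v j), (E i).op_mem _⟩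
      rw [h1, (E i).form_gram] at h2
      refine le_trans (mul_nonneg (hπ i).1.le (sq_nonneg _)) (h2.trans ?_)
      simp
    have := LinearMap.finrank_le_finrank_of_injective hf
    simpa [Module.finrank_pi_fintype] using this

end Pontryagin

/-! ### Resolvents -/

section Resolvent

variable {V : Type*} [NormedAddCommGroup V] [InnerProductSpace ℂ V] {G : V →L[ℂ] V}
  {A : Submodule ℂ (V × V)}

theorem IsResolventAt.unique {z : ℂ} {R R' : V →L[ℂ] V} (h : IsResolventAt A z R)
    (h' : IsResolventAt A z R') : R = R' := by
  ext w
  have h1 : (R w, w + z • R w) ∈ A := (h _ _).2 (by simp)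
  simpa using ((h' _ _).1 h1).symm

theorem isResolventAt_res {z : ℂ} (hz : z ∈ rho A) : IsResolventAt A z (res A z) := by
  have h : ∃ R, IsResolventAt A z R := hz
  rw [res, dif_pos h]
  exact h.choose_spec

theorem IsResolventAt.res_eq {z : ℂ} {R : V →L[ℂ] V} (h : IsResolventAt A z R) : res A z = R :=
  (isResolventAt_res ⟨R, h⟩).unique h

theorem res_mem {z : ℂ} (hz : z ∈ rho A) (w : V) : (res A z w, w + z • res A z w) ∈ A :=
  (isResolventAt_res hz _ _).2 (by simp)

theorem res_apply {z : ℂ} (hz : z ∈ rho A) {x y : V} (h : (x, y) ∈ A) :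
    res A z (y - z • x) = x := (isResolventAt_res hz _ _).1 h

theorem res_sub_res {z w : ℂ} (hz : z ∈ rho A) (hw : w ∈ rho A) (x : V) :
    res A z x - res A w x = (z - w) • res A z (res A w x) := by
  have h := res_apply hz (res_mem hw x)
  have e : x + w • res A w x - z • res A w x = x - (z - w) • res A w x := by
    rw [sub_smul]; abel
  rw [e, map_sub, map_smul] at h
  rw [sub_eq_iff_eq_add] at h ⊢
  exact h.trans (add_comm _ _)

theorem res_comm {z w : ℂ} (hz : z ∈ rho A) (hw : w ∈ rho A) (x : V) :
    res A z (res A w x) = res A w (res A z x) := by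
  by_cases h : z = w
  · rw [h]
  · have h1 := res_sub_res hz hw x
    have h2 := res_sub_res hw hz x
    have h3 : (z - w) • (res A z (res A w x) - res A w (res A z x)) = 0 := by
      rw [smul_sub, ← h1, ← neg_sub w z, neg_smul, ← h2]
      abel
    exact sub_eq_zero.1 ((smul_eq_zero.1 h3).resolve_left (sub_ne_zero.2 h))

theorem form_res (hA : IsSelfAdjointRel G A) {z : ℂ}
    (hz : z ∈ rho A) (hz' : conj z ∈ rho A) (x y : V) :
    form G (res A z x) y = form G x (res A (conj z) y) := by
  have h := (hA _ _).1 (res_mem hz' y) _ _ (res_mem hz x)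
  rw [form_add_left, form_add_right, form_smul_left, form_smul_right] at h
  exact (add_right_cancel h).symm

/-- The operator `I + (z - w)(A - z)⁻¹`. -/
noncomputable def transfer (A : Submodule ℂ (V × V)) (w z : ℂ) : V →L[ℂ] V :=
  ContinuousLinearMap.id ℂ V + (z - w) • res A z

theorem transfer_apply (w z : ℂ) (x : V) : transfer A w z x = x + (z - w) • res A z x := rfl

@[simp] theorem transfer_self (z : ℂ) : transfer A z z = ContinuousLinearMap.id ℂ V := by
  simp [transfer]

/-- The resolvent identity as a cocycle rule: in particular `transfer A w z` and `transfer A z w`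
are mutually inverse. -/
theorem transfer_trans {z w : ℂ} (hz : z ∈ rho A) (hw : w ∈ rho A) (v : ℂ) (x : V) :
    transfer A w z (transfer A v w x) = transfer A v z x := by
  have h := res_sub_res hz hw x
  simp only [transfer_apply, map_add, map_smul]
  linear_combination (norm := module) (v - w) • h

theorem transfer_comm {z w : ℂ} (hz : z ∈ rho A) (hw : w ∈ rho A) (u v : ℂ) (x : V) :
    transfer A u z (transfer A v w x) = transfer A v w (transfer A u z x) := by
  simp only [transfer_apply, map_add, map_smul, smul_add, res_comm hz hw x,
    smul_comm (z - u) (w - v)]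
  abel

theorem form_transfer (hA : IsSelfAdjointRel G A) {z : ℂ} (hz : z ∈ rho A)
    (hz' : conj z ∈ rho A) (w : ℂ) (x y : V) :
    form G (transfer A w z x) y = form G x (transfer A (conj w) (conj z) y) := by
  rw [transfer_apply, transfer_apply, form_add_left, form_add_right, form_smul_left,
    form_smul_right, form_res hA hz hz', map_sub]

/-- `I + (z - conj z)(A - z)⁻¹` preserves the form. -/
theorem form_transfer_conj (hA : IsSelfAdjointRel G A) {z : ℂ} (hz : z ∈ rho A)
    (hz' : conj z ∈ rho A) (x y : V) :
    form G (transfer A (conj z) z x) (transfer A (conj z) z y) = form G x y := by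
  rw [form_transfer hA hz hz', Complex.conj_conj, transfer_trans hz' hz, transfer_self]
  rfl

/-- The operator `transfer A z w` is the inverse of `I + (z - w)(A - z)⁻¹`, which is affine in `w`
and equals `I` at `w = z`; inversion is continuous there. Openness of the resolvent set is not
needed. -/
theorem tendsto_transfer [CompleteSpace V] {z : ℂ} (hz : z ∈ rho A) {S : Set ℂ} (hS : S ⊆ rho A)
    (x : V) : Filter.Tendsto (fun w => transfer A z w x) (nhdsWithin z S) (nhds x) := by
  have h1 : Filter.Tendsto (fun w : ℂ => (1 : V →L[ℂ] V) + (z - w) • res A z) (nhds z)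
      (nhds ((1 : (V →L[ℂ] V)ˣ) : V →L[ℂ] V)) := by
    have : Continuous fun w : ℂ => (1 : V →L[ℂ] V) + (z - w) • res A z := by fun_prop
    simpa using this.tendsto z
  have h2 := (NormedRing.inverse_continuousAt (1 : (V →L[ℂ] V)ˣ)).tendsto.comp h1
  rw [Units.val_one, Ring.inverse_one] at h2
  have h3 : Filter.Tendsto (fun w : ℂ => transfer A z w) (nhdsWithin z S) (nhds 1) := by
    refine (h2.mono_left nhdsWithin_le_nhds).congr' ?_
    filter_upwards [self_mem_nhdsWithin] with w hw
    have e1 : ((1 : V →L[ℂ] V) + (z - w) • res A z) * transfer A z w = 1 := by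
      ext y
      have := transfer_trans hz (hS hw) z y
      rw [transfer_self] at this
      exact this
    have e2 : transfer A z w * ((1 : V →L[ℂ] V) + (z - w) • res A z) = 1 := by
      ext y
      have := transfer_trans (hS hw) hz w y
      rw [transfer_self] at this
      exact this
    exact Ring.inverse_unit (⟨_, _, e1, e2⟩ : (V →L[ℂ] V)ˣ)
  exact ((ContinuousLinearMap.apply ℂ V x).continuous.tendsto 1).comp h3

theorem isClosed_eigenspace (hA : IsSelfAdjointRel G A) (μ : ℂ) :
    IsClosed {x : V | (x, μ • x) ∈ A} := by
  have e : {x : V | (x, μ • x) ∈ A} = ⋂ p : A, {x | form G p.1.2 x = form G p.1.1 (μ • x)} := by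
    ext x
    simp only [Set.mem_ofPred_eq, Set.mem_iInter, hA x (μ • x)]
    exact ⟨fun h p => h _ _ p.2, fun h u v huv => h ⟨_, huv⟩⟩
  rw [e]
  refine isClosed_iInter fun p => isClosed_eq
    ((continuous_form G).comp (continuous_const.prodMk continuous_id))
    ((continuous_form G).comp (continuous_const.prodMk (continuous_const_smul μ)))

end Resolvent

/-! ### Negative eigenvalues of Gram matrices -/

section GramMatrix

variable {V : Type*} [NormedAddCommGroup V] [InnerProductSpace ℂ V] {G : V →L[ℂ] V}
  {n : ℕ} {M : Matrix (Fin n) (Fin n) ℂ} (hM : M.IsHermitian) (f : Fin n → V)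

/-- The combinations of the vectors `f i` that diagonalize their Gram matrix. -/
noncomputable def diagVec (k : Fin n) : V := ∑ i, conj (hM.eigenvectorBasis k i) • f i

/-- Since `M i j = [f j, f i]` has its indices reversed, the coefficients of `diagVec` are
conjugated; the form then becomes `⟪e l, M e k⟫` for the eigenvectors `e`. -/
theorem form_diagVec (hMf : ∀ i j, M i j = form G (f j) (f i)) (k l : Fin n) :
    form G (diagVec hM f k) (diagVec hM f l) = if k = l then (hM.eigenvalues k : ℂ) else 0 := by
  have h1 : form G (diagVec hM f k) (diagVec hM f l)
      = ∑ j, conj (hM.eigenvectorBasis l j) * (M.mulVec (hM.eigenvectorBasis k)) j := by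
    rw [diagVec, diagVec, form_sum_right]
    refine Finset.sum_congr rfl fun j _ => ?_
    rw [form_smul_right, form_sum_left, Matrix.mulVec, dotProduct]
    congr 1
    refine Finset.sum_congr rfl fun i _ => ?_
    rw [form_smul_left, Complex.conj_conj, hMf]
    ring
  have h2 := hM.mulVec_eigenvectorBasis k
  have h3 : inner ℂ (hM.eigenvectorBasis l) (hM.eigenvectorBasis k) = if l = k then (1 : ℂ) else 0 :=
    orthonormal_iff_ite.1 hM.eigenvectorBasis.orthonormal l k
  rw [h1, h2]
  have h4 : ∑ j, conj (hM.eigenvectorBasis l j) * hM.eigenvectorBasis k j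
      = if l = k then (1 : ℂ) else 0 := by
    rw [← h3, PiLp.inner_apply]
    exact Finset.sum_congr rfl fun j _ => by simp [mul_comm]
  simp only [Pi.smul_apply, Complex.real_smul]
  have h5 : ∑ j, conj (hM.eigenvectorBasis l j) * ((hM.eigenvalues k : ℂ) * hM.eigenvectorBasis k j)
      = (hM.eigenvalues k : ℂ) * ∑ j, conj (hM.eigenvectorBasis l j) * hM.eigenvectorBasis k j := by
    rw [Finset.mul_sum]
    exact Finset.sum_congr rfl fun j _ => by ring
  rw [h5, h4]
  by_cases h : k = l
  · simp [h]
  · simp [h, Ne.symm h]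

theorem form_sum_diagVec (hMf : ∀ i j, M i j = form G (f j) (f i)) {ι : Type*} [Fintype ι]
    (e : ι ↪ Fin n) (c : ι → ℂ) :
    (form G (∑ i, c i • diagVec hM f (e i)) (∑ i, c i • diagVec hM f (e i))).re
      = ∑ i, hM.eigenvalues (e i) * ‖c i‖ ^ 2 := by
  classical
  rw [form_sum_left, Complex.re_sum]
  refine Finset.sum_congr rfl fun i _ => ?_
  rw [form_sum_right, Finset.sum_eq_single i]
  · rw [form_self_re_smul, form_diagVec hM f hMf, if_pos rfl, Complex.ofReal_re, mul_comm]
  · intro j _ hj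
    rw [form_smul_left, form_smul_right, form_diagVec hM f hMf,
      if_neg fun h => hj (e.injective h).symm]
    simp
  · intro h
    exact absurd (Finset.mem_univ i) h

theorem isNegativeFamily_diagVec (hMf : ∀ i j, M i j = form G (f j) (f i)) :
    IsNegativeFamily G (fun i : {i : Fin n // hM.eigenvalues i < 0} => diagVec hM f i) := by
  intro c hc
  have := form_sum_diagVec hM f hMf (Function.Embedding.subtype fun i => hM.eigenvalues i < 0) c
  simp only [Function.Embedding.subtype_apply] at this
  rw [this]
  obtain ⟨i, hi⟩ : ∃ i, c i ≠ 0 := by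
    by_contra hcon
    push Not at hcon
    exact hc (funext hcon)
  refine Finset.sum_neg' (fun j _ => mul_nonpos_of_nonpos_of_nonneg j.2.le (by positivity))
    ⟨i, Finset.mem_univ i, mul_neg_of_neg_of_pos i.2 (by positivity)⟩

theorem sum_diagVec (i : Fin n) : ∑ k, hM.eigenvectorBasis k i • diagVec hM f k = f i := by
  classical
  have h : ∀ j, ∑ k, hM.eigenvectorBasis k i * conj (hM.eigenvectorBasis k j)
      = if i = j then (1 : ℂ) else 0 := by
    intro j
    have := hM.eigenvectorBasis.sum_inner_mul_inner (EuclideanSpace.single i (1 : ℂ))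
      (EuclideanSpace.single j (1 : ℂ))
    simpa [EuclideanSpace.inner_single_left, EuclideanSpace.inner_single_right, eq_comm] using this
  simp only [diagVec, Finset.smul_sum, smul_smul]
  rw [Finset.sum_comm]
  simp only [← Finset.sum_smul, h]
  simp

/-- Pairing with the diagonalizing vectors of negative eigenvalue is injective on the span of `v`: a
vector orthogonal to all of them only has components with nonnegative eigenvalues, so its form is
nonnegative. -/
theorem card_le_card_neg_eigenvalues (hMf : ∀ i j, M i j = form G (f j) (f i)) {ι : Type*}
    [Fintype ι] {v : ι → V} (hv : IsNegativeFamily G v)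
    (hvf : ∀ i, v i ∈ Submodule.span ℂ (Set.range f)) :
    Fintype.card ι ≤ Nat.card {i : Fin n // hM.eigenvalues i < 0} := by
  classical
  have hspan : Submodule.span ℂ (Set.range f) ≤ Submodule.span ℂ (Set.range (diagVec hM f)) := by
    rw [Submodule.span_le]
    rintro _ ⟨i, rfl⟩
    rw [← sum_diagVec hM f i]
    exact Submodule.sum_mem _ fun k _ => Submodule.smul_mem _ _ (Submodule.subset_span ⟨k, rfl⟩)
  let φ : (ι → ℂ) →ₗ[ℂ] ({i : Fin n // hM.eigenvalues i < 0} → ℂ) :=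
    LinearMap.pi fun k => ((innerSL ℂ (diagVec hM f k)).comp G : V →ₗ[ℂ] ℂ) ∘ₗ
      Fintype.linearCombination ℂ v
  have hφ : Function.Injective φ := by
    rw [← LinearMap.ker_eq_bot, LinearMap.ker_eq_bot']
    intro a ha
    by_contra hne
    refine absurd (hv a hne) (not_lt.2 ?_)
    set x := ∑ i, a i • v i with hx
    have hxs : x ∈ Submodule.span ℂ (Set.range (diagVec hM f)) :=
      hspan (Submodule.sum_mem _ fun i _ => Submodule.smul_mem _ _ (hvf i))
    obtain ⟨c, hc⟩ := (Submodule.mem_span_range_iff_exists_fun ℂ).1 hxs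
    have h0 : ∀ k, hM.eigenvalues k < 0 → form G (diagVec hM f k) x = 0 :=
      fun k hk => congrFun ha ⟨k, hk⟩
    have h1 : ∀ k, form G (diagVec hM f k) x = hM.eigenvalues k * c k := by
      intro k
      rw [← hc, form_sum_right, Finset.sum_eq_single k]
      · rw [form_smul_right, form_diagVec hM f hMf, if_pos rfl, mul_comm]
      · intro j _ hj
        rw [form_smul_right, form_diagVec hM f hMf, if_neg hj.symm, mul_zero]
      · intro h
        exact absurd (Finset.mem_univ k) h
    have h2 := form_sum_diagVec hM f hMf (Function.Embedding.refl _) c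
    simp only [Function.Embedding.refl_apply, hc] at h2
    rw [h2]
    refine Finset.sum_nonneg fun k _ => ?_
    by_cases hk : hM.eigenvalues k < 0
    · have h3 := h0 k hk
      rw [h1] at h3
      have h4 : c k = 0 := by
        rcases mul_eq_zero.1 h3 with h | h
        · exact absurd (by exact_mod_cast h) hk.ne
        · exact h
      simp [h4]
    · exact mul_nonneg (not_lt.1 hk) (by positivity)
  have := LinearMap.finrank_le_finrank_of_injective hφ
  simpa using this

end GramMatrix

/-! ### The domain of holomorphy -/

section Domain

variable {H : Type*} [NormedAddCommGroup H] [InnerProductSpace ℂ H] [CompleteSpace H]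
  {Q : ℂ → H →L[ℂ] H}

theorem isOpen_domain : IsOpen (domain Q) :=
  (isOpen_ne_fun Complex.continuous_im continuous_const).inter (isOpen_analyticAt ℂ Q)

/-- Near `conj z` the symmetry, applied at conjugate points in `D(Q)`, identifies `Q` with `w ↦
Q(conj w)*`, which is holomorphic. -/
theorem conj_mem_domain (hsymm : ∀ z ∈ domain Q, ContinuousLinearMap.adjoint (Q (conj z)) = Q z)
    {z : ℂ} (hz : z ∈ domain Q) : conj z ∈ domain Q := by
  refine ⟨by simpa using hz.1, ?_⟩
  have h1 : ∀ᶠ w in nhds (conj z), conj w ∈ domain Q :=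
    Complex.continuous_conj.continuousAt.eventually
      (by simpa using isOpen_domain.mem_nhds hz)
  rw [Complex.analyticAt_iff_eventually_differentiableAt]
  filter_upwards [h1.eventually_nhds] with w hw
  have h2 : DifferentiableAt ℂ (star ∘ Q ∘ conj) w := by
    have := (hw.self_of_nhds.2.differentiableAt).star_conj
    simpa using this
  refine h2.congr_of_eventuallyEq ?_
  filter_upwards [hw] with u hu
  have := hsymm _ hu
  rw [Complex.conj_conj] at this
  simp [← this, ContinuousLinearMap.star_eq_adjoint]

theorem dense_domain (hQ : MeromorphicOn Q {z : ℂ | z.im ≠ 0}) : Dense (domain Q) := by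
  have h0 : Dense {z : ℂ | z.im ≠ 0} := by
    have : {z : ℂ | z.im ≠ 0} = Complex.im ⁻¹' {0}ᶜ := rfl
    rw [this]
    exact (dense_compl_singleton (0 : ℝ)).preimage Complex.isOpenMap_im
  refine dense_iff_closure_eq.2 (Set.eq_univ_of_univ_subset ?_)
  rw [← h0.closure_eq]
  refine closure_minimal (fun z hz => ?_) isClosed_closure
  have h1 : ∀ᶠ w in nhdsWithin z {z}ᶜ, w ∈ domain Q := by
    filter_upwards [(hQ z hz).eventually_analyticAt,
      nhdsWithin_le_nhds ((isOpen_ne_fun Complex.continuous_im continuous_const).mem_nhds hz)]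
      with w hw1 hw2 using ⟨hw2, hw1⟩
  exact mem_closure_iff_frequently.2 (h1.frequently.filter_mono nhdsWithin_le_nhds)

end Domain

/-! ### The Nevanlinna kernel of a minimal representation -/

section Kernel

variable {H : Type*} [NormedAddCommGroup H] [InnerProductSpace ℂ H] [CompleteSpace H]
  {V : Type*} [NormedAddCommGroup V] [InnerProductSpace ℂ V]
  {Q : ℂ → H →L[ℂ] H} {G : V →L[ℂ] V} {A : Submodule ℂ (V × V)} {γ : ℂ → H →L[ℂ] V}

/-- The closed span of the vectors `γ z h` with `z ∈ D(Q)` in the upper half plane. -/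
def upperSpan (Q : ℂ → H →L[ℂ] H) (γ : ℂ → H →L[ℂ] V) : Submodule ℂ V :=
  (Submodule.span ℂ {v : V | ∃ z ∈ domain Q, 0 < z.im ∧ ∃ h, v = γ z h}).topologicalClosure

theorem mem_upperSpan {z : ℂ} (hz : z ∈ domain Q) (hz' : 0 < z.im) (h : H) :
    γ z h ∈ upperSpan Q γ :=
  Submodule.le_topologicalClosure _ (Submodule.subset_span ⟨z, hz, hz', h, rfl⟩)

theorem isClosed_upperSpan : IsClosed (upperSpan Q γ : Set V) :=
  Submodule.isClosed_topologicalClosure _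

/-- The set `s` collects the conjugates of the finitely many lower half plane points occurring in
`x`. It is fixed before `W`, so that one `W` can later be built for several vectors at once. -/
theorem exists_finset_mem_upperSpan (hconj : ∀ z ∈ domain Q, conj z ∈ domain Q) {x : V}
    (hx : x ∈ Submodule.span ℂ {v : V | ∃ z ∈ domain Q, ∃ h, v = γ z h}) :
    ∃ s : Finset ℂ, (∀ z ∈ s, z ∈ domain Q ∧ 0 < z.im) ∧
      ∀ W : V →ₗ[ℂ] V, (∀ x ∈ upperSpan Q γ, W x ∈ upperSpan Q γ) →
        (∀ z ∈ s, ∀ h, W (γ (conj z) h) ∈ upperSpan Q γ) → W x ∈ upperSpan Q γ := by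
  classical
  induction hx using Submodule.span_induction with
  | mem x hx =>
    obtain ⟨z, hz, h, rfl⟩ := hx
    rcases lt_or_gt_of_ne hz.1 with hneg | hpos
    · refine ⟨{conj z}, fun w hw => ?_, fun W _ hW => ?_⟩
      · rw [Finset.mem_singleton.1 hw]
        exact ⟨hconj z hz, by simpa using hneg⟩
      · simpa using hW (conj z) (Finset.mem_singleton_self _) h
    · exact ⟨∅, by simp, fun W hW _ => hW _ (mem_upperSpan hz hpos h)⟩
  | zero => exact ⟨∅, by simp, fun W _ _ => by simp⟩
  | add x y _ _ hx hy =>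
    obtain ⟨s, hs, hs'⟩ := hx
    obtain ⟨t, ht, ht'⟩ := hy
    refine ⟨s ∪ t, fun z hz => (Finset.mem_union.1 hz).elim (hs z) (ht z), fun W hW hW' => ?_⟩
    rw [map_add]
    exact Submodule.add_mem _ (hs' W hW fun z hz => hW' z (Finset.mem_union_left _ hz))
      (ht' W hW fun z hz => hW' z (Finset.mem_union_right _ hz))
  | smul c x _ hx =>
    obtain ⟨s, hs, hs'⟩ := hx
    refine ⟨s, hs, fun W hW hW' => ?_⟩
    rw [map_smul]
    exact Submodule.smul_mem _ _ (hs' W hW hW')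

theorem exists_finset_span {ι : Type*} [Finite ι] {S : Set V} {v : ι → V}
    (hv : ∀ i, v i ∈ Submodule.span ℂ S) :
    ∃ (n : ℕ) (f : Fin n → V), (∀ j, f j ∈ S) ∧ ∀ i, v i ∈ Submodule.span ℂ (Set.range f) := by
  classical
  have := Fintype.ofFinite ι
  choose T hTS hT using fun i => Submodule.mem_span_finite_of_mem_span (hv i)
  let U := Finset.univ.biUnion T
  refine ⟨U.card, fun j => (U.equivFin.symm j : V), fun j => ?_, fun i => ?_⟩
  · obtain ⟨i, -, hi⟩ := Finset.mem_biUnion.1 (U.equivFin.symm j).2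
    exact hTS i hi
  · refine Submodule.span_mono (fun x hx => ?_) (hT i)
    have hxU : x ∈ U := Finset.mem_biUnion.2 ⟨i, Finset.mem_univ i, hx⟩
    exact ⟨U.equivFin ⟨x, hxU⟩, by simp⟩

variable [CompleteSpace V]

/-- For `v ≠ z` the vector is a difference quotient of the `γ`-field; the case `v = z` is the limit
of `w → z` through other points of the upper half plane. -/
theorem res_mem_upperSpan (hdom : domain Q ⊆ rho A)
    (hγ : ∀ z ∈ rho A, ∀ w ∈ rho A, ∀ h, transfer A w z (γ w h) = γ z h) {z v : ℂ}
    (hz : z ∈ domain Q) (hz' : 0 < z.im) (hv : v ∈ domain Q) (hv' : 0 < v.im) (h : H) :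
    res A z (γ v h) ∈ upperSpan Q γ := by
  have key : ∀ w ∈ domain Q, 0 < w.im → w ≠ z → res A z (γ w h) ∈ upperSpan Q γ := by
    intro w hw hw' hwz
    have h1 := hγ z (hdom hz) w (hdom hw) h
    have h2 : res A z (γ w h) = (z - w)⁻¹ • (γ z h - γ w h) := by
      rw [← h1, transfer_apply, add_sub_cancel_left, smul_smul,
        inv_mul_cancel₀ (sub_ne_zero.2 hwz.symm), one_smul]
    rw [h2]
    exact Submodule.smul_mem _ _
      (Submodule.sub_mem _ (mem_upperSpan hz hz' h) (mem_upperSpan hw hw' h))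
  by_cases hvz : v = z
  · subst hvz
    have h1 : Filter.Tendsto (fun w => γ w h) (nhdsWithin v {v}ᶜ) (nhds (γ v h)) := by
      have := tendsto_transfer (A := A) (hdom hv) hdom (γ v h)
      rw [isOpen_domain.nhdsWithin_eq hv] at this
      refine (this.mono_left nhdsWithin_le_nhds).congr' ?_
      filter_upwards [nhdsWithin_le_nhds (isOpen_domain.mem_nhds hv)] with w hw
      exact hγ w (hdom hw) v (hdom hv) h
    refine isClosed_upperSpan.mem_of_tendsto (((res A v).continuous.tendsto _).comp h1) ?_
    filter_upwards [nhdsWithin_le_nhds (isOpen_domain.mem_nhds hv), self_mem_nhdsWithin,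
      nhdsWithin_le_nhds ((isOpen_lt continuous_const Complex.continuous_im).mem_nhds hv')]
      with w hw1 hw2 hw3 using key w hw1 hw3 hw2
  · exact key v hv hv' hvz

theorem transfer_mem_upperSpan (hdom : domain Q ⊆ rho A)
    (hγ : ∀ z ∈ rho A, ∀ w ∈ rho A, ∀ h, transfer A w z (γ w h) = γ z h) {z : ℂ}
    (hz : z ∈ domain Q) (hz' : 0 < z.im) (w : ℂ) {x : V} (hx : x ∈ upperSpan Q γ) :
    transfer A w z x ∈ upperSpan Q γ := by
  have : upperSpan Q γ ≤ (upperSpan Q γ).comap (transfer A w z : V →ₗ[ℂ] V) := by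
    refine Submodule.topologicalClosure_minimal _ ?_
      (isClosed_upperSpan.preimage (transfer A w z).continuous)
    rw [Submodule.span_le]
    rintro _ ⟨v, hv, hv', h, rfl⟩
    exact Submodule.add_mem _ (mem_upperSpan hv hv' h)
      (Submodule.smul_mem _ _ (res_mem_upperSpan hdom hγ hz hz' hv hv' h))
  exact this hx

/-- Finitely many vectors `γ z h` with `z` in the lower half plane are moved to the closed span for
the upper half plane by an operator that preserves the form. -/
theorem exists_isometry_mem_upperSpan (hA : IsSelfAdjointRel G A) (hdom : domain Q ⊆ rho A)
    (hconj : ∀ z ∈ domain Q, conj z ∈ domain Q)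
    (hγ : ∀ z ∈ rho A, ∀ w ∈ rho A, ∀ h, transfer A w z (γ w h) = γ z h) (s : Finset ℂ)
    (hs : ∀ z ∈ s, z ∈ domain Q ∧ 0 < z.im) :
    ∃ W : V →ₗ[ℂ] V, (∀ x, form G (W x) (W x) = form G x x) ∧
      (∀ x ∈ upperSpan Q γ, W x ∈ upperSpan Q γ) ∧
      (∀ z ∈ domain Q, ∀ x, W (transfer A (conj z) z x) = transfer A (conj z) z (W x)) ∧
      ∀ z ∈ s, ∀ h, W (γ (conj z) h) ∈ upperSpan Q γ := by
  classical
  induction s using Finset.induction_on with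
  | empty => exact ⟨LinearMap.id, by simp, by simp, by simp, by simp⟩
  | insert z s _ ih =>
    obtain ⟨W, h1, h2, h3, h4⟩ := ih fun z hz => hs z (Finset.mem_insert_of_mem hz)
    obtain ⟨hz, hz'⟩ := hs z (Finset.mem_insert_self _ _)
    have hzc := hconj z hz
    -- The new isometry lifts `γ (conj z) h` to `γ z h`. For the older points it is moved past `W`
    -- by the commutation clause, which is why that clause is part of the induction.
    refine ⟨W ∘ₗ (transfer A (conj z) z : V →ₗ[ℂ] V), fun x => ?_, fun x hx => ?_,
      fun w hw x => ?_, fun w hw h => ?_⟩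
    · exact (h1 _).trans (form_transfer_conj hA (hdom hz) (hdom hzc) x x)
    · exact h2 _ (transfer_mem_upperSpan hdom hγ hz hz' _ hx)
    · change W (transfer A (conj z) z (transfer A (conj w) w x)) = _
      rw [transfer_comm (hdom hz) (hdom hw), h3 w hw]
      rfl
    · change W (transfer A (conj z) z (γ (conj w) h)) ∈ _
      rcases Finset.mem_insert.1 hw with rfl | hw
      · rw [hγ _ (hdom hz) _ (hdom hzc)]
        exact h2 _ (mem_upperSpan hz hz' h)
      · rw [h3 z hz]
        exact transfer_mem_upperSpan hdom hγ hz hz' _ (h4 w hw h)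

/-- Each `γ z h` is the limit of `γ w h` as `w → z` within `D(Q)`, which is dense in the plane. -/
theorem closure_span_domain (hmero : MeromorphicOn Q {z : ℂ | z.im ≠ 0}) (hdom : domain Q ⊆ rho A)
    (hγ : ∀ z ∈ rho A, ∀ w ∈ rho A, ∀ h, transfer A w z (γ w h) = γ z h)
    (hmin : (Submodule.span ℂ {v : V | ∃ z ∈ rho A, ∃ h, v = γ z h}).topologicalClosure = ⊤) :
    (Submodule.span ℂ {v : V | ∃ z ∈ domain Q, ∃ h, v = γ z h}).topologicalClosure = ⊤ := by
  rw [eq_top_iff, ← hmin]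
  refine Submodule.topologicalClosure_minimal _ ?_ (Submodule.isClosed_topologicalClosure _)
  rw [Submodule.span_le]
  rintro _ ⟨z, hz, h, rfl⟩
  have h1 := tendsto_transfer (A := A) hz hdom (γ z h)
  have : (nhdsWithin z (domain Q)).NeBot := mem_closure_iff_nhdsWithin_neBot.1
    ((dense_domain hmero).closure_eq ▸ Set.mem_univ z)
  refine (Submodule.isClosed_topologicalClosure _).mem_of_tendsto h1 ?_
  filter_upwards [self_mem_nhdsWithin] with w hw
  rw [hγ w (hdom hw) z hz]
  exact Submodule.le_topologicalClosure _ (Submodule.subset_span ⟨w, hw, h, rfl⟩)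

/-- A function whose Nevanlinna kernel is represented by a minimal `γ`-field in a Pontryagin space
of index `κ` belongs to `N_κ(H)`. -/
theorem isGeneralizedNevanlinna_of_minimal {κ : ℕ}
    (hmero : MeromorphicOn Q {z : ℂ | z.im ≠ 0})
    (hsymm : ∀ z ∈ domain Q, ContinuousLinearMap.adjoint (Q (conj z)) = Q z)
    (hP : IsPontryagin G κ) (hA : IsSelfAdjointRel G A) (hdom : domain Q ⊆ rho A)
    (hγ : ∀ z ∈ rho A, ∀ w ∈ rho A, ∀ h, transfer A w z (γ w h) = γ z h)
    (hker : ∀ z ∈ domain Q, ∀ w ∈ domain Q, 0 < z.im → 0 < w.im → ∀ g h,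
      inner ℂ h (kernel Q z w g) = form G (γ w h) (γ z g))
    (hmin : (Submodule.span ℂ {v : V | ∃ z ∈ rho A, ∃ h, v = γ z h}).topologicalClosure = ⊤) :
    IsGeneralizedNevanlinna κ Q := by
  classical
  have hconj : ∀ z ∈ domain Q, conj z ∈ domain Q := fun z hz => conj_mem_domain hsymm hz
  have hmat : ∀ {n : ℕ} (z : Fin n → ℂ) (h : Fin n → H),
      (∀ i, z i ∈ domain Q ∧ 0 < (z i).im) → ∀ i j,
      kernelMatrix Q z h i j = form G (γ (z j) (h j)) (γ (z i) (h i)) := fun z h hz i j =>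
    hker _ (hz i).1 _ (hz j).1 (hz i).2 (hz j).2 _ _
  have hle : ∀ (n : ℕ) (z : Fin n → ℂ) (h : Fin n → H),
      (∀ i, z i ∈ domain Q ∧ 0 < (z i).im) → negCount Q z h ≤ κ := by
    intro n z h hz
    have := hP.card_le (isNegativeFamily_diagVec (kernelMatrix_isHermitian Q z h)
      (fun i => γ (z i) (h i)) (hmat z h hz))
    rwa [← Nat.card_eq_fintype_card] at this
  refine ⟨hmero, hsymm, hle, ?_⟩
  obtain ⟨v, hv⟩ := hP.exists_isNegativeFamily
  have hcl := closure_span_domain hmero hdom hγ hmin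
  -- A maximal negative family is perturbed twice: first into the span over all of `D(Q)`, then,
  -- after the isometry `W` has moved it to the closed upper span, into the upper span itself.
  obtain ⟨w, hwS, hw⟩ := hv.exists_of_mem_closure (S := (Submodule.span ℂ
    {v : V | ∃ z ∈ domain Q, ∃ h, v = γ z h} : Submodule ℂ V)) fun i => by
      rw [← Submodule.topologicalClosure_coe, hcl]
      trivial
  choose s hs hs' using fun i => exists_finset_mem_upperSpan hconj (hwS i)
  obtain ⟨W, hW1, hW2, -, hW4⟩ := exists_isometry_mem_upperSpan hA hdom hconj hγ
    (Finset.univ.biUnion s) fun z hz => by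
      obtain ⟨i, -, hi⟩ := Finset.mem_biUnion.1 hz
      exact hs i z hi
  have hWw : ∀ i, W (w i) ∈ upperSpan Q γ := fun i => hs' i W hW2 fun z hz h =>
    hW4 z (Finset.mem_biUnion.2 ⟨i, Finset.mem_univ i, hz⟩) h
  obtain ⟨u, huS, hu⟩ := (hw.map W hW1).exists_of_mem_closure (S := (Submodule.span ℂ
    {v : V | ∃ z ∈ domain Q, 0 < z.im ∧ ∃ h, v = γ z h} : Submodule ℂ V)) fun i => by
      rw [← Submodule.topologicalClosure_coe]
      exact hWw i
  obtain ⟨n, f, hf, hfu⟩ := exists_finset_span huS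
  choose z hz hz' h hfh using hf
  obtain rfl : f = fun j => γ (z j) (h j) := funext hfh
  have hzz : ∀ i, z i ∈ domain Q ∧ 0 < (z i).im := fun i => ⟨hz i, hz' i⟩
  refine ⟨n, z, h, hzz, le_antisymm (hle n z h hzz) ?_⟩
  have := card_le_card_neg_eigenvalues (kernelMatrix_isHermitian Q z h)
    (fun i => γ (z i) (h i)) (hmat z h hzz) hu hfu
  rwa [Fintype.card_fin] at this

theorem IsGeneralizedNevanlinna.index_unique {k m : ℕ} (hk : IsGeneralizedNevanlinna k Q)
    (hm : IsGeneralizedNevanlinna m Q) : k = m := by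
  obtain ⟨n, z, h, hz, e⟩ := hk.neg_eq
  obtain ⟨n', z', h', hz', e'⟩ := hm.neg_eq
  exact le_antisymm (e ▸ hm.neg_le n z h hz) (e' ▸ hk.neg_le n' z' h' hz')

end Kernel

/-! ### Parts of a selfadjoint relation -/

section Parts

variable {H : Type*} [NormedAddCommGroup H] [InnerProductSpace ℂ H]
  {K : Type*} [NormedAddCommGroup K] [InnerProductSpace ℂ K] {G : K →L[ℂ] K}
  {A : Submodule ℂ (K × K)}

namespace OrthProj

/-- The projection reduces the relation `A`. -/
def Reduces (E : OrthProj G) (A : Submodule ℂ (K × K)) : Prop :=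
  ∀ x y, (x, y) ∈ A → (E.op x, E.op y) ∈ A

/-- The projection as an operator onto its range. -/
def proj (E : OrthProj G) : K →L[ℂ] E.space := E.op.codRestrict E.space E.op_mem

@[simp] theorem coe_proj (E : OrthProj G) (x : K) : (E.proj x : K) = E.op x := rfl

theorem proj_coe (E : OrthProj G) (x : E.space) : E.proj x = x := Subtype.ext (E.op_eq x.2)

theorem mem_part (E : OrthProj G) {x y : E.space} : (x, y) ∈ E.part A ↔ ((x : K), (y : K)) ∈ A :=
  Iff.rfl

variable {E F : OrthProj G}

theorem Reduces.sub (hF : F.Reduces A) (hE : E.Reduces A)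
    (h₁ : ∀ x, F.op (E.op x) = E.op x) (h₂ : ∀ x, E.op (F.op x) = E.op x) :
    (F.sub E h₁ h₂).Reduces A := fun x y h => A.sub_mem (hF x y h) (hE x y h)

theorem Reduces.op_res (hE : E.Reduces A) {z : ℂ} (hz : z ∈ rho A) (x : K) :
    E.op (res A z x) = res A z (E.op x) := by
  have h := res_apply hz (hE _ _ (res_mem hz x))
  rw [map_add, map_smul, add_sub_cancel_right] at h
  exact h.symm

theorem Reduces.isResolventAt_part (hE : E.Reduces A) {z : ℂ} (hz : z ∈ rho A) :
    IsResolventAt (E.part A) z (E.proj.comp ((res A z).comp E.space.subtypeL)) := by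
  intro x y
  rw [mem_part, isResolventAt_res hz]
  constructor
  · intro h
    apply Subtype.ext
    change E.op (res A z (y - z • x : K)) = x
    rw [h, E.op_eq x.2]
  · intro h
    have h1 : E.op (res A z ((y - z • x : E.space) : K)) = x := congrArg Subtype.val h
    rw [hE.op_res hz, E.op_eq (y - z • x).2] at h1
    exact h1

theorem Reduces.rho_subset (hE : E.Reduces A) : rho A ⊆ rho (E.part A) :=
  fun _ hz => ⟨_, hE.isResolventAt_part hz⟩

theorem Reduces.coe_res (hE : E.Reduces A) {z : ℂ} (hz : z ∈ rho A) (x : E.space) :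
    (res (E.part A) z x : K) = res A z x := by
  rw [(hE.isResolventAt_part hz).res_eq]
  change E.op (res A z x) = _
  rw [hE.op_res hz, E.op_eq x.2]

theorem Reduces.res_proj (hE : E.Reduces A) {z : ℂ} (hz : z ∈ rho A) (x : K) :
    res (E.part A) z (E.proj x) = E.proj (res A z x) :=
  Subtype.ext (by rw [hE.coe_res hz, coe_proj, coe_proj, hE.op_res hz])

theorem Reduces.transfer_proj (hE : E.Reduces A) {z : ℂ} (hz : z ∈ rho A) (w : ℂ) (x : K) :
    transfer (E.part A) w z (E.proj x) = E.proj (transfer A w z x) := by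
  rw [transfer_apply, transfer_apply, hE.res_proj hz, map_add, map_smul]

theorem Reduces.part_graph (hE : E.Reduces A) {T : K →L[ℂ] K} (hT : A = (T : K →ₗ[ℂ] K).graph) :
    E.part A = ((E.proj.comp (T.comp E.space.subtypeL) : E.space →L[ℂ] E.space) :
      E.space →ₗ[ℂ] E.space).graph := by
  ext ⟨x, y⟩
  rw [mem_part, hT, LinearMap.mem_graph_iff, LinearMap.mem_graph_iff]
  have hTE : E.op (T x) = T x := by
    have h1 := hE x (T x) (by rw [hT]; exact (LinearMap.mem_graph_iff _ _).2 rfl)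
    rw [hT] at h1
    have h2 : E.op (T x) = T (E.op x) := (LinearMap.mem_graph_iff _ _).1 h1
    rw [h2, E.op_eq x.2]
  change (y : K) = T x ↔ y = E.proj (T x)
  rw [Subtype.ext_iff, coe_proj, hTE]

theorem dense_span_proj (E : OrthProj G) {S : Set K} {S' : Set E.space}
    (hS : (Submodule.span ℂ S).topologicalClosure = ⊤) (hSS' : ∀ x ∈ S, E.proj x ∈ S') :
    (Submodule.span ℂ S').topologicalClosure = ⊤ := by
  have h : (Submodule.span ℂ S).topologicalClosure ≤
      (Submodule.span ℂ S').topologicalClosure.comap (E.proj : K →ₗ[ℂ] E.space) := by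
    refine Submodule.topologicalClosure_minimal _ (Submodule.span_le.2 fun x hx => ?_)
      ((Submodule.isClosed_topologicalClosure _).preimage E.proj.continuous)
    exact Submodule.le_topologicalClosure _ (Submodule.subset_span (hSS' x hx))
  rw [eq_top_iff]
  intro x _
  have := h (hS ▸ Submodule.mem_top : (x : K) ∈ _)
  rwa [Submodule.mem_comap, ContinuousLinearMap.coe_coe, E.proj_coe] at this

/-- The projection onto a subspace on which `A` contains an everywhere defined operator reduces
`A`. -/
theorem reduces_of_operator {κ : ℕ} (hP : IsPontryagin G κ) (hA : IsSelfAdjointRel G A)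
    (E : OrthProj G) (T : E.space →L[ℂ] E.space) (hT : ∀ x : E.space, ((x : K), (T x : K)) ∈ A) :
    E.Reduces A ∧ E.part A = (T : E.space →ₗ[ℂ] E.space).graph := by
  -- Selfadjointness tested against `(E w, T E w)` gives `[T E w, x] = [E w, y]`, and for the pair
  -- `(E x, T E x)` it gives `[T E w, E x] = [E w, T E x]`. The left-hand sides agree.
  have key : ∀ x y, (x, y) ∈ A → E.proj y = T (E.proj x) := by
    intro x y hxy
    refine Subtype.ext (hP.eq_of_forall_form' fun w => ?_)
    have h1 := (hA x y).1 hxy _ _ (hT (E.proj w))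
    have h2 := (hA _ _).1 (hT (E.proj x)) _ _ (hT (E.proj w))
    rw [← E.op_eq (T (E.proj w)).2, E.symm] at h1
    rw [coe_proj] at h1
    rw [coe_proj E x] at h2
    rw [coe_proj, ← E.symm, ← h1, h2, coe_proj, E.symm, E.op_eq (T (E.proj x)).2]
  refine ⟨fun x y hxy => ?_, ?_⟩
  · have := hT (E.proj x)
    rw [← key x y hxy] at this
    exact this
  · ext ⟨x, y⟩
    rw [mem_part, LinearMap.mem_graph_iff]
    constructor
    · intro h
      have := key _ _ h
      rwa [E.proj_coe, E.proj_coe] at this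
    · intro h
      have h1 : y = T x := h
      rw [h1]
      exact hT x

variable [CompleteSpace K]

theorem Reduces.isSelfAdjointRel (hE : E.Reduces A) (hA : IsSelfAdjointRel G A) :
    IsSelfAdjointRel E.gram (E.part A) := by
  intro x y
  rw [mem_part, hA]
  simp only [E.form_gram]
  constructor
  · intro h u v huv
    exact h _ _ huv
  · intro h u v huv
    have := h (E.proj u) (E.proj v) (hE u v huv)
    rwa [coe_proj, coe_proj, E.symm, E.symm, E.op_eq x.2, E.op_eq y.2] at this

end OrthProj

end Parts

/-! ### Maximal positive eigenspaces -/

section MaximalPositive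

variable {K : Type*} [NormedAddCommGroup K] [InnerProductSpace ℂ K]
  {G : K →L[ℂ] K} {A : Submodule ℂ (K × K)} {α : ℝ} {κ : ℕ}

/-- The eigenspace `ker (A - μ)`. -/
def eigenspace (A : Submodule ℂ (K × K)) (μ : ℂ) : Submodule ℂ K where
  carrier := {x | (x, μ • x) ∈ A}
  add_mem' {x y} hx hy := by
    have := A.add_mem hx hy
    rwa [Prod.mk_add_mk, ← smul_add] at this
  zero_mem' := by
    change ((0 : K), μ • (0 : K)) ∈ A
    rw [smul_zero]
    exact A.zero_mem
  smul_mem' c x hx := by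
    have := A.smul_mem c hx
    rwa [Prod.smul_mk, smul_comm] at this

/-- Eigenvectors orthogonal to a maximal positive eigenspace are nonpositive. -/
theorem IsMaximalPositiveEigenspace.nonpos (hG : ∀ x y, form G y x = conj (form G x y))
    {K₀ : Submodule ℂ K} (h : IsMaximalPositiveEigenspace G A α K₀) {x : K}
    (hx : (x, (α : ℂ) • x) ∈ A) (hxK : ∀ y ∈ K₀, form G y x = 0) : (form G x x).re ≤ 0 := by
  by_contra hpos
  push Not at hpos
  have hmax : IsPositiveEigenspace G A α (K₀ ⊔ Submodule.span ℂ {x}) := by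
    refine ⟨?_, fun y hy => ?_, fun y hy hy0 => ?_⟩
    · exact Submodule.isClosed_sup_finiteDimensional _ _ h.1.closed
    · have hle : K₀ ⊔ Submodule.span ℂ {x} ≤ eigenspace A (α : ℂ) :=
        sup_le h.1.eigen ((Submodule.span_singleton_le_iff_mem _ _).2 hx)
      exact hle hy
    · obtain ⟨u, hu, w, hw, rfl⟩ := Submodule.mem_sup.1 hy
      obtain ⟨c, rfl⟩ := Submodule.mem_span_singleton.1 hw
      have h1 : form G u (c • x) = 0 := by rw [form_smul_right, hxK u hu, mul_zero]
      have h2 : form G (c • x) u = 0 := by rw [hG u, h1, map_zero]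
      rw [form_add_left, form_add_right, form_add_right, h1, h2, Complex.add_re, add_zero,
        zero_add, form_self_re_smul]
      by_cases hu0 : u = 0
      · have hc : c ≠ 0 := by
          rintro rfl
          simp [hu0] at hy0
        rw [hu0]
        simp only [form_zero_left, Complex.zero_re, zero_add]
        positivity
      · have := h.1.pos u hu hu0
        positivity
  have hxmem : x ∈ K₀ := by
    rw [← h.2 _ hmax le_sup_left]
    exact Submodule.mem_sup_right (Submodule.mem_span_singleton_self x)
  rw [hxK x hxmem] at hpos
  simp at hpos

variable [CompleteSpace K]

/-- By Gårding's inequality the eigenvectors in `ker π` form a positive subspace `B`. Among the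
admissible `M` containing `B`, one with `π M` of maximal dimension is maximal: a larger `M'` has the
same image, so every vector of `M'` differs from one of `M` by an element of `B`. -/
theorem exists_isMaximalPositiveEigenspace (hP : IsPontryagin G κ) (hA : IsSelfAdjointRel G A) :
    ∃ K₀ : Submodule ℂ K, IsMaximalPositiveEigenspace G A α K₀ := by
  classical
  obtain ⟨π, c, C, hc, hC, hπ⟩ := hP.exists_isGarding
  set B : Submodule ℂ K := eigenspace A (α : ℂ) ⊓ LinearMap.ker (π : K →ₗ[ℂ] (Fin κ → ℂ)) with hB
  let S : ℕ → Prop := fun d => ∃ M, IsPositiveEigenspace G A α M ∧ B ≤ M ∧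
    d ≤ Module.finrank ℂ (M.map (π : K →ₗ[ℂ] (Fin κ → ℂ)))
  have hS0 : S 0 := by
    refine ⟨B, ⟨?_, fun x hx => hx.1, fun x hx hx0 => ?_⟩, le_rfl, Nat.zero_le _⟩
    · exact (isClosed_eigenspace hA _).inter (isClosed_singleton.preimage π.continuous)
    · have h1 := hπ x
      have h2 : π x = 0 := hx.2
      rw [h2] at h1
      have : 0 < c * ‖x‖ ^ 2 := by positivity
      simp at h1
      linarith
  have hSb : ∀ d, S d → d ≤ κ := by
    rintro d ⟨M, -, -, hd⟩
    exact hd.trans ((Submodule.finrank_le _).trans (by simp))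
  obtain ⟨M, hM, hBM, hd⟩ : S (Nat.findGreatest S κ) := Nat.findGreatest_spec (Nat.zero_le κ) hS0
  refine ⟨M, hM, fun M' hM' hle => le_antisymm (fun x hx => ?_) hle⟩
  have hS' : S (Module.finrank ℂ (M'.map (π : K →ₗ[ℂ] (Fin κ → ℂ)))) := ⟨M', hM', hBM.trans hle, le_rfl⟩
  have h1 := Nat.le_findGreatest (hSb _ hS') hS'
  have h2 : M.map (π : K →ₗ[ℂ] (Fin κ → ℂ)) = M'.map (π : K →ₗ[ℂ] (Fin κ → ℂ)) :=
    Submodule.eq_of_le_of_finrank_le (Submodule.map_mono hle) (h1.trans hd)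
  have h3 : π x ∈ M.map (π : K →ₗ[ℂ] (Fin κ → ℂ)) := h2 ▸ Submodule.mem_map_of_mem hx
  obtain ⟨y, hy, hyx⟩ := Submodule.mem_map.1 h3
  have h4 : x - y ∈ B := by
    refine ⟨hM'.eigen _ (M'.sub_mem hx (hle hy)), ?_⟩
    change π (x - y) = 0
    rw [map_sub, sub_eq_zero]
    exact hyx.symm
  have := M.add_mem (hBM h4) hy
  rwa [sub_add_cancel] at this

theorem IsPositiveEigenspace.exists_orthProj (hP : IsPontryagin G κ) {M : Submodule ℂ K}
    (hM : IsPositiveEigenspace G A α M) : ∃ E : OrthProj G, E.space = M := by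
  obtain ⟨π, c, C, hπ⟩ := hP.exists_isGarding
  obtain ⟨d, hd, hdM⟩ := hπ.exists_uniform hM.closed hM.pos
  exact exists_orthProj_of_uniform hP.hermitian hM.closed hd hdM

end MaximalPositive

/-! ### Cyclic vectors of nilpotent operators -/

section Cyclic

variable {W : Type*} [AddCommGroup W] [Module ℂ W]

/-- If `u` is cyclic for the nilpotent operator `N`, `N ^ l = 0`, and `N ^ (l - 1) v ≠ 0`, then `v`
is cyclic. -/
theorem span_pow_eq_top_of_nilpotent {N : Module.End ℂ W} {l : ℕ} {u v : W}
    (hu : Submodule.span ℂ (Set.range fun i : Fin l => (N ^ (i : ℕ)) u) = ⊤) (hl : N ^ l = 0)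
    (hl0 : 0 < l) (hv : (N ^ (l - 1)) v ≠ 0) :
    Submodule.span ℂ (Set.range fun i : Fin l => (N ^ (i : ℕ)) v) = ⊤ := by
  have hzero : ∀ j, l ≤ j → ∀ x, (N ^ j) x = 0 := by
    intro j hj x
    rw [← Nat.sub_add_cancel hj, pow_add, hl, mul_zero, LinearMap.zero_apply]
  set S := Submodule.span ℂ (Set.range fun i : Fin l => (N ^ (i : ℕ)) v) with hS
  have hvS : ∀ j, (N ^ j) v ∈ S := by
    intro j
    by_cases hj : j < l
    · exact Submodule.subset_span ⟨⟨j, hj⟩, rfl⟩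
    · rw [hzero j (not_lt.1 hj)]
      exact S.zero_mem
  obtain ⟨a, ha⟩ := (Submodule.mem_span_range_iff_exists_fun ℂ).1
    (hu ▸ Submodule.mem_top : v ∈ Submodule.span ℂ (Set.range fun i : Fin l => (N ^ (i : ℕ)) u))
  obtain ⟨n, rfl⟩ : ∃ n, l = n + 1 := ⟨l - 1, by omega⟩
  have hpow : ∀ j, (N ^ j) v = a 0 • (N ^ j) u
      + ∑ i : Fin n, a i.succ • (N ^ (j + ((i : ℕ) + 1))) u := by
    intro j
    conv_lhs => rw [← ha]
    rw [map_sum, Fin.sum_univ_succ]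
    simp only [map_smul, ← Module.End.mul_apply, ← pow_add, Fin.val_zero, add_zero, Fin.val_succ]
  -- Only the leading term of `v` survives `N ^ (l - 1)`.
  have ha0 : a 0 ≠ 0 := by
    intro h0
    apply hv
    rw [hpow, h0, zero_smul, zero_add]
    exact Finset.sum_eq_zero fun i _ => by rw [hzero _ (by omega), smul_zero]
  -- Downward induction on the exponent `j`: `N ^ j u` is solved from `N ^ j v` and higher powers of
  -- `N` applied to `u`.
  have huS : ∀ m j, n + 1 ≤ j + m → (N ^ j) u ∈ S := by
    intro m
    induction m using Nat.strong_induction_on with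
    | _ m ih =>
      intro j hj
      by_cases hjn : n + 1 ≤ j
      · rw [hzero j hjn]
        exact S.zero_mem
      · have h1 : a 0 • (N ^ j) u = (N ^ j) v
            - ∑ i : Fin n, a i.succ • (N ^ (j + ((i : ℕ) + 1))) u := by
          rw [hpow j, add_sub_cancel_right]
        have h2 : a 0 • (N ^ j) u ∈ S := by
          rw [h1]
          refine S.sub_mem (hvS j) (Submodule.sum_mem _ fun i _ => S.smul_mem _ ?_)
          exact ih (m - 1) (by omega) _ (by omega)
        have h3 := S.smul_mem (a 0)⁻¹ h2
        rwa [smul_smul, inv_mul_cancel₀ ha0, one_smul] at h3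
  rw [eq_top_iff, ← hu, Submodule.span_le]
  rintro _ ⟨i, rfl⟩
  exact huS (n + 1) _ (by omega)

end Cyclic

/-! ### Splitting off Jordan chains -/

section Jordan

theorem OrthProj.eq_zero_of_form {K : Type*} [NormedAddCommGroup K] [InnerProductSpace ℂ K]
    {G : K →L[ℂ] K} {κ : ℕ} {E : OrthProj G} (hP : IsPontryagin G κ) {x : K}
    (hx : x ∈ E.space) (h : ∀ w ∈ E.space, form G x w = 0) : x = 0 := by
  refine hP.eq_zero_of_forall_form fun y => ?_
  rw [← E.op_eq hx, E.symm]
  exact h _ (E.op_mem y)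

variable {H : Type*} [NormedAddCommGroup H] [InnerProductSpace ℂ H]
  {K : Type*} [NormedAddCommGroup K] [InnerProductSpace ℂ K] [CompleteSpace K]
  {G : K →L[ℂ] K} {A : Submodule ℂ (K × K)} {Γ : H →L[ℂ] K} {α : ℝ} {κ : ℕ}

/-- The range of `Γ` is cyclic for the resolvents of `A`. -/
def IsCyclic (A : Submodule ℂ (K × K)) (Γ : H →L[ℂ] K) : Prop :=
  ∀ W : Submodule ℂ K, IsClosed (W : Set K) → (∀ h, Γ h ∈ W) →
    (∀ z ∈ rho A, ∀ x ∈ W, res A z x ∈ W) → W = ⊤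

/-- The part of `A` is the graph of a bounded operator `T` with `(T - α) ^ n = 0`. -/
def IsNilpotentPart (A : Submodule ℂ (K × K)) (α : ℝ) (E : OrthProj G) : Prop :=
  ∃ (T : E.space →L[ℂ] E.space) (n : ℕ), E.part A = (T : E.space →ₗ[ℂ] E.space).graph ∧
    (T - (α : ℂ) • ContinuousLinearMap.id ℂ E.space) ^ n = 0

/-- A relation maps a finite-dimensional invariant subspace by an operator, if the form does not
degenerate there. -/
theorem OrthProj.exists_operator {K : Type*} [NormedAddCommGroup K] [InnerProductSpace ℂ K]
    {G : K →L[ℂ] K} {A : Submodule ℂ (K × K)} {κ : ℕ} (hP : IsPontryagin G κ)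
    (hA : IsSelfAdjointRel G A) (E : OrthProj G) [FiniteDimensional ℂ E.space]
    (hinv : ∀ m ∈ E.space, ∃ m' ∈ E.space, (m, m') ∈ A) :
    ∃ T : E.space →L[ℂ] E.space, ∀ x : E.space, ((x : K), (T x : K)) ∈ A := by
  choose f hfE hf using hinv
  -- Although `A` may be multivalued, two images in `E K` of the same vector have the same pairing
  -- with all of `E K`, where the form does not degenerate.
  have huniq : ∀ m a b, a ∈ E.space → b ∈ E.space → (m, a) ∈ A → (m, b) ∈ A → a = b := by
    intro m a b ha hb hma hmb
    refine sub_eq_zero.1 (OrthProj.eq_zero_of_form hP (E.space.sub_mem ha hb) fun w hw => ?_)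
    have h1 := (hA _ _).1 (hf w hw) _ _ hma
    have h2 := (hA _ _).1 (hf w hw) _ _ hmb
    rw [form_sub_left, h1, h2, sub_self]
  let T : E.space →ₗ[ℂ] E.space :=
    { toFun := fun x => ⟨f x x.2, hfE x x.2⟩
      map_add' := fun x y => Subtype.ext (huniq (x + y : E.space) _ _ (hfE _ _)
        (E.space.add_mem (hfE _ _) (hfE _ _)) (hf _ _) (A.add_mem (hf x x.2) (hf y y.2)))
      map_smul' := fun c x => Subtype.ext (huniq (c • x : E.space) _ _ (hfE _ _)
        (E.space.smul_mem c (hfE _ _)) (hf _ _) (A.smul_mem c (hf x x.2))) }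
  exact ⟨LinearMap.toContinuousLinearMap T, fun x => hf x x.2⟩

theorem clm_mul_apply {V : Type*} [NormedAddCommGroup V] [InnerProductSpace ℂ V]
    (f g : V →L[ℂ] V) (x : V) : (f * g) x = f (g x) := rfl

theorem mem_graph_iff_sub {V : Type*} [NormedAddCommGroup V] [InnerProductSpace ℂ V]
    (T : V →L[ℂ] V) (μ : ℂ) (x y : V) :
    (x, μ • x + y) ∈ (T : V →ₗ[ℂ] V).graph ↔ (T - μ • ContinuousLinearMap.id ℂ V) x = y := by
  rw [LinearMap.mem_graph_iff]
  change μ • x + y = T x ↔ T x - μ • x = y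
  rw [sub_eq_iff_eq_add', eq_comm]

/-- The resolvent of the graph of `T` commutes with `T`. -/
theorem res_comm_of_graph {V : Type*} [NormedAddCommGroup V] [InnerProductSpace ℂ V]
    {B : Submodule ℂ (V × V)} {T : V →L[ℂ] V} (hB : B = (T : V →ₗ[ℂ] V).graph) {z : ℂ}
    (hz : z ∈ rho B) (μ : ℂ) (n : ℕ) (x : V) :
    ((T - μ • ContinuousLinearMap.id ℂ V) ^ n) (res B z x)
      = res B z (((T - μ • ContinuousLinearMap.id ℂ V) ^ n) x) := by
  have h1 : ∀ x, T (res B z x) = res B z (T x) := by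
    intro x
    have h2 : x + z • res B z x = T (res B z x) := by
      have := res_mem hz x
      rw [hB] at this
      rw [hB]
      exact (LinearMap.mem_graph_iff _ _).1 this
    have h3 := res_apply hz (x := x) (y := T x) (by
      rw [hB]
      exact (LinearMap.mem_graph_iff _ _).2 rfl)
    rw [map_sub, map_smul, sub_eq_iff_eq_add] at h3
    rw [← h2, h3]
  have h4 : Commute (T - μ • ContinuousLinearMap.id ℂ V) (res B z) := by
    ext x
    change T (res B z x) - μ • res B z x = res B z (T x - μ • x)
    rw [map_sub, map_smul, h1]
  exact congrArg (fun f : V →L[ℂ] V => f x) (h4.pow_left n).eq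

/-- The span of a nondegenerate Jordan chain whose eigenvector is nonpositive is a Jordan part. -/
theorem exists_isJordanPart (hP : IsPontryagin G κ) (hA : IsSelfAdjointRel G A)
    (hΓ : IsCyclic A Γ) {l : ℕ} {x : Fin l → K} (hx : IsJordanChain A (α : ℂ) x)
    (hnd : Nondegenerate G (Submodule.span ℂ (Set.range x)))
    (hneg : (form G (x ⟨0, hx.pos⟩) (x ⟨0, hx.pos⟩)).re ≤ 0) :
    ∃ E : OrthProj G, E.space = Submodule.span ℂ (Set.range x) ∧ E.Reduces A ∧
      IsNilpotentPart A α E ∧ IsJordanPart G A Γ α E ∧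
      ∃ w ∈ E.space, (form G w w).re < 0 := by
  set M := Submodule.span ℂ (Set.range x) with hM
  have hMfin : FiniteDimensional ℂ M := FiniteDimensional.span_of_finite ℂ (Set.finite_range x)
  obtain ⟨E, hE⟩ := exists_orthProj_of_nondegenerate hP.hermitian hnd
  have hEfin : FiniteDimensional ℂ E.space := hE ▸ hMfin
  have hxE : ∀ k, x k ∈ E.space := fun k => hE ▸ Submodule.subset_span ⟨k, rfl⟩
  have hinv : ∀ m ∈ E.space, ∃ m' ∈ E.space, (m, m') ∈ A := by
    intro m hm
    rw [hE] at hm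
    induction hm using Submodule.span_induction with
    | mem y hy =>
      obtain ⟨k, rfl⟩ := hy
      by_cases hk : k.val = 0
      · exact ⟨_, E.space.smul_mem _ (hxE k), (hx.first k hk).2⟩
      · exact ⟨_, E.space.add_mem (E.space.smul_mem _ (hxE k))
          (hxE ⟨k.val - 1, by omega⟩), hx.next ⟨k.val - 1, by omega⟩ k (by simp; omega)⟩
    | zero => exact ⟨0, E.space.zero_mem, A.zero_mem⟩
    | add a b _ _ ha hb =>
      obtain ⟨a', ha', haA⟩ := ha
      obtain ⟨b', hb', hbA⟩ := hb
      exact ⟨_, E.space.add_mem ha' hb', A.add_mem haA hbA⟩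
    | smul c a _ ha =>
      obtain ⟨a', ha', haA⟩ := ha
      exact ⟨_, E.space.smul_mem c ha', A.smul_mem c haA⟩
  obtain ⟨T, hT⟩ := E.exists_operator hP hA hinv
  obtain ⟨hred, hpart⟩ := OrthProj.reduces_of_operator hP hA E T hT
  set N : E.space →L[ℂ] E.space := T - (α : ℂ) • ContinuousLinearMap.id ℂ E.space with hN
  have hl := hx.pos
  let X : Fin l → E.space := fun k => ⟨x k, hxE k⟩
  have hX0 : ∀ k : Fin l, k.val = 0 → N (X k) = 0 := by
    intro k hk
    have : (X k, (α : ℂ) • X k + 0) ∈ E.part A := by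
      rw [add_zero]
      exact (hx.first k hk).2
    rw [hpart] at this
    exact (mem_graph_iff_sub T _ _ _).1 this
  have hXs : ∀ j k : Fin l, k.val = j.val + 1 → N (X k) = X j := by
    intro j k hjk
    have : (X k, (α : ℂ) • X k + X j) ∈ E.part A := hx.next j k hjk
    rw [hpart] at this
    exact (mem_graph_iff_sub T _ _ _).1 this
  have hXspan : Submodule.span ℂ (Set.range X) = ⊤ := by
    have h1 : (Submodule.span ℂ (Set.range X)).map E.space.subtype = E.space := by
      rw [Submodule.map_span, ← Set.range_comp]
      exact hE.symm
    rw [eq_top_iff]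
    intro y _
    have h2 : (y : K) ∈ (Submodule.span ℂ (Set.range X)).map E.space.subtype := h1.symm ▸ y.2
    obtain ⟨y', hy', e⟩ := Submodule.mem_map.1 h2
    rwa [← Subtype.ext e]
  let u : E.space := X ⟨l - 1, by omega⟩
  have hXu : ∀ j (hj : j < l), (N ^ j) u = X ⟨l - 1 - j, by omega⟩ := by
    intro j
    induction j with
    | zero => intro _; rfl
    | succ j ih =>
      intro hj
      rw [pow_succ', clm_mul_apply, ih (by omega)]
      exact hXs _ _ (by simp; omega)
  have hNl : N ^ l = 0 := by
    have h1 : (N ^ l) u = 0 := by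
      obtain ⟨n, rfl⟩ : ∃ n, l = n + 1 := ⟨l - 1, by omega⟩
      rw [pow_succ', clm_mul_apply, hXu n (by omega)]
      exact hX0 _ (by simp)
    have h2 : ∀ y ∈ Submodule.span ℂ (Set.range X), (N ^ l) y = 0 := by
      intro y hy
      induction hy using Submodule.span_induction with
      | mem y hy =>
        obtain ⟨k, rfl⟩ := hy
        have h3 := hXu (l - 1 - k.val) (by omega)
        have h4 : (⟨l - 1 - (l - 1 - k.val), by omega⟩ : Fin l) = k := Fin.ext (by simp; omega)
        rw [h4] at h3
        rw [← h3, ← clm_mul_apply, ← pow_add, add_comm, pow_add,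
          clm_mul_apply, h1, map_zero]
      | zero => exact map_zero _
      | add a b _ _ ha hb => rw [map_add, ha, hb, add_zero]
      | smul c a _ ha => rw [map_smul, ha, smul_zero]
    ext y
    rw [h2 y (hXspan ▸ Submodule.mem_top)]
    rfl
  have hu0 : (N ^ (l - 1)) u ≠ 0 := by
    rw [hXu (l - 1) (by omega)]
    intro h0
    exact (hx.first ⟨l - 1 - (l - 1), by omega⟩ (by simp)).1 (congrArg Subtype.val h0)
  -- The kernel of `N ^ (l - 1) E` is closed and invariant under the resolvents. If it contained the
  -- range of `Γ`, cyclicity would make it all of `K`, but it does not contain `u`.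
  obtain ⟨h, hh⟩ : ∃ h, (N ^ (l - 1)) (E.comp Γ h) ≠ 0 := by
    by_contra hcon
    push Not at hcon
    have hW := hΓ (LinearMap.ker ((N ^ (l - 1)).comp E.proj : K →ₗ[ℂ] E.space))
      (isClosed_singleton.preimage ((N ^ (l - 1)).comp E.proj).continuous) hcon
      fun z hz y hy => by
        change (N ^ (l - 1)) (E.proj (res A z y)) = 0
        rw [← hred.res_proj hz, res_comm_of_graph hpart (hred.rho_subset hz)]
        change res _ z ((N ^ (l - 1)) (E.proj y)) = 0
        rw [show (N ^ (l - 1)) (E.proj y) = 0 from hy, map_zero]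
    have h1 : (u : K) ∈ LinearMap.ker ((N ^ (l - 1)).comp E.proj : K →ₗ[ℂ] E.space) :=
      hW ▸ Submodule.mem_top
    have h2 : (N ^ (l - 1)) (E.proj u) = 0 := h1
    rw [E.proj_coe] at h2
    exact hu0 h2
  set v := E.comp Γ h with hv
  have hcoe : ∀ (j : ℕ) (y : E.space), ((N : Module.End ℂ E.space) ^ j) y = (N ^ j) y := by
    intro j
    induction j with
    | zero => intro y; rfl
    | succ j ih =>
      intro y
      rw [pow_succ, pow_succ, Module.End.mul_apply, clm_mul_apply, ih]
      rfl
  have hspan : Submodule.span ℂ (Set.range (chainFrom T α l v)) = ⊤ := by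
    have h1 : Submodule.span ℂ (Set.range fun i : Fin l =>
        ((N : Module.End ℂ E.space) ^ (i : ℕ)) u) = ⊤ := by
      rw [eq_top_iff, ← hXspan, Submodule.span_le]
      rintro _ ⟨k, rfl⟩
      refine Submodule.subset_span ⟨⟨l - 1 - k.val, by omega⟩, ?_⟩
      simp only [hcoe]
      rw [hXu _ (by omega)]
      congr 1
      exact Fin.ext (by simp; omega)
    have h2 := span_pow_eq_top_of_nilpotent (v := v) h1 (by
      ext y
      rw [hcoe, hNl]
      rfl) hl (by rw [hcoe]; exact hh)
    rw [eq_top_iff, ← h2, Submodule.span_le]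
    rintro _ ⟨i, rfl⟩
    refine Submodule.subset_span ⟨⟨l - 1 - i.val, by omega⟩, ?_⟩
    simp only [hcoe, chainFrom]
    congr 2
    omega
  have hchain : IsJordanChain (E.part A) (α : ℂ) (chainFrom T α l v) := by
    refine ⟨hl, fun k hk => ⟨?_, ?_⟩, fun j k hjk => ?_⟩
    · rw [chainFrom, hk, Nat.sub_zero]
      exact hh
    · have h1 : N (chainFrom T α l v k) = 0 := by
        have h2 : N * N ^ (l - 1 - k.val) = 0 := by
          rw [← pow_succ', hk, Nat.sub_zero, Nat.sub_add_cancel hl, hNl]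
        exact congrArg (fun f : E.space →L[ℂ] E.space => f v) h2
      have h3 := (mem_graph_iff_sub T (α : ℂ) _ _).2 h1
      rwa [add_zero, ← hpart] at h3
    · rw [hpart]
      refine (mem_graph_iff_sub T (α : ℂ) _ _).2 ?_
      have h2 : N * N ^ (l - 1 - k.val) = N ^ (l - 1 - j.val) := by
        rw [← pow_succ']
        congr 1
        omega
      exact congrArg (fun f : E.space →L[ℂ] E.space => f v) h2
  have hgram : Nondegenerate E.gram ⊤ := by
    intro a _ ha
    refine Subtype.ext (OrthProj.eq_zero_of_form hP a.2 fun w hw => ?_)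
    rw [← ha ⟨w, hw⟩ trivial, E.form_gram]
  refine ⟨E, hE, hred, ⟨T, l, hpart, hNl⟩, ⟨fun μ => ⟨?_, ?_⟩, T, l, h, hpart, hchain, ?_, hspan,
    ?_⟩, ?_⟩
  · rintro ⟨y, hy0, hy⟩
    have h1 : N y = (μ - (α : ℂ)) • y := by
      rw [hpart] at hy
      refine (mem_graph_iff_sub T (α : ℂ) y _).1 ?_
      rwa [← add_smul, add_sub_cancel]
    have h2 : ∀ j, (N ^ j) y = (μ - (α : ℂ)) ^ j • y := by
      intro j
      induction j with
      | zero => simp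
      | succ j ih =>
        rw [pow_succ, clm_mul_apply, h1, map_smul, ih, smul_smul, pow_succ']
    have h3 := h2 l
    rw [hNl] at h3
    have h4 := (smul_eq_zero.1 h3.symm).resolve_right hy0
    exact sub_eq_zero.1 (pow_eq_zero_iff hl.ne' |>.1 h4)
  · rintro rfl
    exact ⟨_, hchain.first ⟨0, hl⟩ rfl⟩
  · rw [hspan]
    exact hgram
  · rintro ⟨y, hy⟩
    obtain ⟨h1, h2⟩ := hchain.first ⟨0, hl⟩ rfl
    set y₀ := chainFrom T α l v ⟨0, hl⟩ with hy₀
    -- Since `α` is real, the eigenvector `y₀` is orthogonal to the range of `A - α`. If the chain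
    -- could be prolonged, that range would contain the whole chain, and `y₀` would be isotropic in
    -- its span.
    have horth : ∀ a b : K, (a, (α : ℂ) • a + b) ∈ A → form G (y₀ : K) b = 0 := by
      intro a b hab
      have h3 := (hA _ _).1 hab _ _ h2
      change form G ((α : ℂ) • (y₀ : K)) a = _ at h3
      change _ = form G (y₀ : K) _ at h3
      rw [form_smul_left, form_add_right, form_smul_right, Complex.conj_ofReal] at h3
      exact left_eq_add.1 h3
    refine h1 (hgram y₀ trivial fun w _ => ?_)
    have hw : w ∈ Submodule.span ℂ (Set.range (chainFrom T α l v)) := hspan ▸ Submodule.mem_top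
    induction hw using Submodule.span_induction with
    | mem w hw =>
      obtain ⟨k, rfl⟩ := hw
      rw [E.form_gram]
      by_cases hk : k.val + 1 < l
      · exact horth _ _ (hchain.next k ⟨k.val + 1, hk⟩ rfl)
      · have : chainFrom T α l v k = v := by
          rw [chainFrom, show l - 1 - k.val = 0 by omega]
          rfl
        rw [this]
        exact horth _ _ hy
    | zero => exact form_zero_right _ _
    | add a b _ _ ha hb => rw [form_add_right, ha trivial, hb trivial, add_zero]
    | smul c a _ ha => rw [form_smul_right, ha trivial, mul_zero]
  · have hx0 := (hx.first ⟨0, hl⟩ rfl).1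
    -- The eigenvector is nonpositive and not orthogonal to the span, so `exists_form_neg` provides
    -- a negative vector.
    obtain ⟨w, hw, hne⟩ : ∃ w ∈ E.space, form G (x ⟨0, hl⟩) w ≠ 0 := by
      by_contra hcon
      push Not at hcon
      exact hx0 (OrthProj.eq_zero_of_form hP (hxE _) hcon)
    obtain ⟨t, ht⟩ := exists_form_neg hP.hermitian hneg hne
    exact ⟨_, E.space.add_mem hw (E.space.smul_mem t (hxE _)), ht⟩

end Jordan

/-! ### The orthogonal decomposition of the space -/

section Decomposition

variable {H : Type*} [NormedAddCommGroup H] [InnerProductSpace ℂ H]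
  {K : Type*} [NormedAddCommGroup K] [InnerProductSpace ℂ K]
  {G : K →L[ℂ] K} {A : Submodule ℂ (K × K)} {Γ : H →L[ℂ] K} {α : ℝ} {κ : ℕ}

theorem isNegativeFamily_singleton {w : K} (hw : (form G w w).re < 0) :
    IsNegativeFamily G (fun _ : Fin 1 => w) := by
  intro c hc
  have hc0 : c 0 ≠ 0 := fun h => hc (funext fun i => by rw [Subsingleton.elim i 0, h]; rfl)
  rw [Fin.sum_univ_one, form_self_re_smul]
  exact mul_neg_of_pos_of_neg (by positivity) hw

theorem IsJordanChain.coe (F : OrthProj G) {l : ℕ} {x : Fin l → F.space} {μ : ℂ}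
    (hx : IsJordanChain (F.part A) μ x) : IsJordanChain A μ fun k => (x k : K) :=
  ⟨hx.pos, fun k hk => ⟨fun h => (hx.first k hk).1 (Subtype.ext h), (hx.first k hk).2⟩, hx.next⟩

theorem OrthProj.span_coe_le (F : OrthProj G) {ι : Type*} (x : ι → F.space) :
    Submodule.span ℂ (Set.range fun k => (x k : K)) ≤ F.space := by
  rw [Submodule.span_le]
  rintro _ ⟨k, rfl⟩
  exact (x k).2

variable [CompleteSpace K]

theorem OrthProj.nondegenerate_coe (F : OrthProj G) {ι : Type*} {x : ι → F.space}
    (h : Nondegenerate F.gram (Submodule.span ℂ (Set.range x))) :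
    Nondegenerate G (Submodule.span ℂ (Set.range fun k => (x k : K))) := by
  have e : Submodule.span ℂ (Set.range fun k => (x k : K))
      = (Submodule.span ℂ (Set.range x)).map F.space.subtype := by
    rw [Submodule.map_span, ← Set.range_comp]
    rfl
  rw [e]
  rintro _ ⟨v, hv, rfl⟩ hvw
  have : v = 0 := h v hv fun w hw => by
    rw [F.form_gram]
    exact hvw _ ⟨w, hw, rfl⟩
  rw [this, map_zero]

/-- A reducing subspace on which the eigenvectors at `α` are nonpositive splits into Jordan parts
and a remainder in which all Jordan chains are degenerate. -/
theorem exists_jordan_splitting (hP : IsPontryagin G κ) (hA : IsSelfAdjointRel G A)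
    (hΓ : IsCyclic A Γ) (k : ℕ) : ∀ F : OrthProj G, F.Reduces A →
    (∀ x ∈ F.space, (x, (α : ℂ) • x) ∈ A → (form G x x).re ≤ 0) →
    (∀ (m : ℕ) (v : Fin m → K), (∀ i, v i ∈ F.space) → IsNegativeFamily G v → m ≤ k) →
    ∃ (r : ℕ) (E : Fin (r + 1) → OrthProj G),
      (∀ i j, i ≠ j → ∀ x, (E i).op ((E j).op x) = 0) ∧ (∀ x, ∑ i, (E i).op x = F.op x) ∧
      (∀ i, (E i).Reduces A) ∧
      (∀ i : Fin r, IsNilpotentPart A α (E i.castSucc) ∧ IsJordanPart G A Γ α (E i.castSucc)) ∧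
      ∀ (l : ℕ) (x : Fin l → (E (Fin.last r)).space),
        IsJordanChain ((E (Fin.last r)).part A) (α : ℂ) x →
        ¬ Nondegenerate (E (Fin.last r)).gram (Submodule.span ℂ (Set.range x)) := by
  -- Here `k` bounds the size of negative families in `F K`. A split-off Jordan part contains a
  -- negative vector orthogonal to the remainder, so the bound drops by one.
  induction k with
  | zero =>
    intro F hF hneg hk
    refine ⟨0, fun _ => F, fun i j hij => absurd (Fin.ext (by omega)) hij, by simp,
      fun _ => hF, fun i => i.elim0, fun l x hx hnd => ?_⟩
    obtain ⟨E, hE, -, -, -, w, hw, hw0⟩ := exists_isJordanPart hP hA hΓ (hx.coe F)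
      (OrthProj.nondegenerate_coe F hnd) (hneg _ (x _).2 (hx.first ⟨0, hx.pos⟩ rfl).2)
    have := hk 1 (fun _ => w) (fun _ => (hE ▸ F.span_coe_le x : E.space ≤ F.space) hw)
      (isNegativeFamily_singleton hw0)
    omega
  | succ k ih =>
    intro F hF hneg hk
    by_cases hdeg : ∀ (l : ℕ) (x : Fin l → F.space), IsJordanChain (F.part A) (α : ℂ) x →
        ¬ Nondegenerate F.gram (Submodule.span ℂ (Set.range x))
    · exact ⟨0, fun _ => F, fun i j hij => absurd (Fin.ext (by omega)) hij, by simp,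
        fun _ => hF, fun i => i.elim0, hdeg⟩
    push Not at hdeg
    obtain ⟨l, x, hx, hnd⟩ := hdeg
    obtain ⟨E, hE, hEr, hEn, hEJ, w, hw, hw0⟩ := exists_isJordanPart hP hA hΓ (hx.coe F)
      (OrthProj.nondegenerate_coe F hnd) (hneg _ (x _).2 (hx.first ⟨0, hx.pos⟩ rfl).2)
    have hle : E.space ≤ F.space := hE ▸ F.span_coe_le x
    have hFE : ∀ x, F.op (E.op x) = E.op x := fun x => F.op_eq (hle (E.op_mem x))
    -- `E F = E` is the adjoint of `F E = E` with respect to the form.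
    have hEF : ∀ x, E.op (F.op x) = E.op x := fun x => hP.eq_of_forall_form fun y => by
      rw [E.symm, F.symm, hFE, ← E.symm]
    set F' := F.sub E hFE hEF with hF'
    have hF'op : ∀ x, F'.op x = F.op x - E.op x := fun x => rfl
    have hF'le : F'.space ≤ F.space := by
      rintro _ ⟨x, rfl⟩
      exact F.space.sub_mem (F.op_mem x) (hle (E.op_mem x))
    have hEF' : ∀ x, E.op (F'.op x) = 0 := fun x => by
      rw [hF'op, map_sub, hEF, E.idem, sub_self]
    have hF'E : ∀ x, F'.op (E.op x) = 0 := fun x => by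
      rw [hF'op, hFE, E.idem, sub_self]
    obtain ⟨r, E', h1, h2, h3, h4, h5⟩ := ih F' (hF.sub hEr hFE hEF)
      (fun x hx => hneg x (hF'le hx)) fun m v hv hvn => by
        have := hk (m + 1) (Fin.cons w v) (Fin.cases (hle hw) fun i => hF'le (hv i))
          (hvn.cons hP.hermitian hw0 fun i => by
            rw [← E.op_eq hw, E.symm, ← F'.op_eq (hv i), hEF', form_zero_right])
        omega
    have hE'F' : ∀ j x, F'.op ((E' j).op x) = (E' j).op x := by
      intro j x
      rw [← h2, Finset.sum_eq_single j, (E' j).idem]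
      · exact fun i _ hij => h1 i j hij x
      · exact fun h => absurd (Finset.mem_univ j) h
    have hF'E' : ∀ j x, (E' j).op (F'.op x) = (E' j).op x := by
      intro j x
      rw [← h2, map_sum, Finset.sum_eq_single j, (E' j).idem]
      · exact fun i _ hij => h1 j i hij.symm x
      · exact fun h => absurd (Finset.mem_univ j) h
    refine ⟨r + 1, Fin.cons E E', ?_, fun x => ?_, Fin.cases hEr h3, ?_, h5⟩
    · refine Fin.cases (Fin.cases (fun h => absurd rfl h) fun j _ x => ?_)
        fun i => Fin.cases (fun _ x => ?_) fun j hij x => ?_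
      · simp only [Fin.cons_zero, Fin.cons_succ]
        rw [← hE'F', hEF']
      · simp only [Fin.cons_zero, Fin.cons_succ]
        rw [← hF'E', hF'E, map_zero]
      · simp only [Fin.cons_succ]
        exact h1 i j (fun h => hij (by rw [h])) x
    · rw [Fin.sum_univ_succ]
      simp only [Fin.cons_zero, Fin.cons_succ]
      rw [h2, hF'op, add_sub_cancel]
    · exact Fin.cases ⟨hEn, hEJ⟩ h4

/-- The decomposition of the space with respect to a maximal positive eigenspace. -/
theorem exists_isJordanDecomposition (hP : IsPontryagin G κ) (hA : IsSelfAdjointRel G A)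
    (hΓ : IsCyclic A Γ) {K₀ : Submodule ℂ K} (hK₀ : IsMaximalPositiveEigenspace G A α K₀) :
    ∃ (r : ℕ) (E : Fin (r + 2) → OrthProj G) (k : Fin (r + 2) → ℕ),
      IsJordanDecomposition G A Γ α κ K₀ E k ∧
      ∀ j : Fin (r + 1), IsNilpotentPart A α (E j.castSucc) := by
  obtain ⟨E₀, rfl⟩ := hK₀.1.exists_orthProj hP
  have hT : ∀ x : E₀.space, ((x : K),
      (((α : ℂ) • ContinuousLinearMap.id ℂ E₀.space : E₀.space →L[ℂ] E₀.space) x : K)) ∈ A :=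
    fun x => hK₀.1.eigen x x.2
  obtain ⟨hred, hpart⟩ := OrthProj.reduces_of_operator hP hA E₀ _ hT
  -- On `K₀` the relation acts as `α I`, so the exponent is one.
  have hnil : IsNilpotentPart A α E₀ := ⟨_, 1, hpart, by simp⟩
  set F := OrthProj.one.sub E₀ (fun _ => rfl) (fun _ => rfl) with hF
  have hFop : ∀ x, F.op x = x - E₀.op x := fun _ => rfl
  have hE₀F : ∀ x, E₀.op (F.op x) = 0 := fun x => by rw [hFop, map_sub, E₀.idem, sub_self]
  have hFE₀ : ∀ x, F.op (E₀.op x) = 0 := fun x => by rw [hFop, E₀.idem, sub_self]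
  have horthF : ∀ y ∈ E₀.space, ∀ x ∈ F.space, form G y x = 0 := by
    intro y hy x hx
    rw [← E₀.op_eq hy, E₀.symm, ← F.op_eq hx, hE₀F, form_zero_right]
  have hFred : F.Reduces A := fun x y hxy => A.sub_mem hxy (hred x y hxy)
  obtain ⟨r, E', h1, h2, h3, h4, h5⟩ := exists_jordan_splitting hP hA hΓ κ F hFred
    (fun x hx hxA => hK₀.nonpos hP.hermitian hxA fun y hy => horthF y hy x hx)
    fun m v _ hv => by simpa using hP.card_le hv
  have hE'F : ∀ j x, F.op ((E' j).op x) = (E' j).op x := by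
    intro j x
    rw [← h2, Finset.sum_eq_single j, (E' j).idem]
    · exact fun i _ hij => h1 i j hij x
    · exact fun h => absurd (Finset.mem_univ j) h
  have hFE' : ∀ j x, (E' j).op (F.op x) = (E' j).op x := by
    intro j x
    rw [← h2, map_sum, Finset.sum_eq_single j, (E' j).idem]
    · exact fun i _ hij => h1 j i hij.symm x
    · exact fun h => absurd (Finset.mem_univ j) h
  set E : Fin (r + 2) → OrthProj G := Fin.cons E₀ E' with hE
  have horth : ∀ i j, i ≠ j → ∀ x, (E i).op ((E j).op x) = 0 := by
    refine Fin.cases (Fin.cases (fun h => absurd rfl h) fun j _ x => ?_)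
      fun i => Fin.cases (fun _ x => ?_) fun j hij x => ?_
    · simp only [hE, Fin.cons_zero, Fin.cons_succ]
      rw [← hE'F, hE₀F]
    · simp only [hE, Fin.cons_zero, Fin.cons_succ]
      rw [← hFE', hFE₀, map_zero]
    · simp only [hE, Fin.cons_succ]
      exact h1 i j (fun h => hij (by rw [h])) x
  have hsum : ∀ x, ∑ i, (E i).op x = x := by
    intro x
    rw [Fin.sum_univ_succ]
    simp only [hE, Fin.cons_zero, Fin.cons_succ]
    rw [h2, hFop, add_sub_cancel]
  choose k hk using fun i => (E i).exists_isPontryagin hP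
  have hk0 : k 0 = 0 := by
    by_contra hne
    obtain ⟨v, hv⟩ := (hk 0).exists_isNegativeFamily
    have h0 : v ⟨0, Nat.pos_of_ne_zero hne⟩ ≠ 0 := hv.linearIndependent.ne_zero _
    have h6 := hv.form_neg_of_mem_span (Submodule.subset_span ⟨_, rfl⟩) h0
    rw [(E 0).form_gram] at h6
    exact absurd (hK₀.1.pos _ (v ⟨0, Nat.pos_of_ne_zero hne⟩).2 fun h => h0 (Subtype.ext h))
      (not_lt.2 h6.le)
  have hksum := hP.index_sum E hsum horth hk
  rw [Fin.sum_univ_succ, hk0, zero_add] at hksum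
  refine ⟨r, E, k, ⟨fun i j hij => ContinuousLinearMap.ext (horth i j hij), ?_, hk, hk0, hksum,
    Fin.cases hred h3, rfl, fun x hx hxK => hK₀.nonpos hP.hermitian hx hxK,
    fun i => (h4 i).2, h5⟩, Fin.cases hnil fun i => (h4 i).1⟩
  ext x
  simpa using hsum x

end Decomposition

/-! ### Resolvents of operators with one point in the spectrum -/

section NilpotentGraph

variable {V : Type*} [NormedAddCommGroup V] [InnerProductSpace ℂ V] {A : Submodule ℂ (V × V)}
  {T : V →L[ℂ] V}

theorem isResolventAt_graph (hA : A = (T : V →ₗ[ℂ] V).graph) {z : ℂ}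
    (h : IsUnit (T - z • (1 : V →L[ℂ] V))) :
    IsResolventAt A z (Ring.inverse (T - z • (1 : V →L[ℂ] V))) := by
  intro x y
  have h1 : ∀ x, Ring.inverse (T - z • (1 : V →L[ℂ] V)) (T x - z • x) = x := fun x =>
    congrArg (fun f : V →L[ℂ] V => f x) (Ring.inverse_mul_cancel _ h)
  have h2 : ∀ x, T (Ring.inverse (T - z • (1 : V →L[ℂ] V)) x)
      - z • Ring.inverse (T - z • (1 : V →L[ℂ] V)) x = x := fun x =>
    congrArg (fun f : V →L[ℂ] V => f x) (Ring.mul_inverse_cancel _ h)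
  rw [hA, LinearMap.mem_graph_iff]
  change y = T x ↔ _
  constructor
  · rintro rfl
    exact h1 x
  · intro hx
    have := h2 (y - z • x)
    rw [hx, sub_left_inj] at this
    exact this.symm

/-- `T - z` is the nonzero scalar `μ - z` plus a commuting nilpotent operator. -/
theorem isUnit_sub_of_nilpotent {μ : ℂ} {n : ℕ}
    (hn : (T - μ • ContinuousLinearMap.id ℂ V) ^ n = 0) {z : ℂ} (hz : z ≠ μ) :
    IsUnit (T - z • (1 : V →L[ℂ] V)) := by
  have e : T - z • (1 : V →L[ℂ] V)
      = (μ - z) • (1 : V →L[ℂ] V) + (T - μ • ContinuousLinearMap.id ℂ V) := by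
    change T - z • (1 : V →L[ℂ] V) = (μ - z) • (1 : V →L[ℂ] V) + (T - μ • (1 : V →L[ℂ] V))
    rw [sub_smul]
    abel
  rw [e]
  refine IsNilpotent.isUnit_add_left_of_commute ⟨n, hn⟩ ?_ ?_
  · exact (isUnit_one.smul (Units.mk0 (μ - z) (sub_ne_zero.2 hz.symm)))
  · exact (Commute.one_right _).smul_right _

theorem mem_rho_of_nilpotent (hA : A = (T : V →ₗ[ℂ] V).graph) {μ : ℂ} {n : ℕ}
    (hn : (T - μ • ContinuousLinearMap.id ℂ V) ^ n = 0) {z : ℂ} (hz : z ≠ μ) : z ∈ rho A :=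
  ⟨_, isResolventAt_graph hA (isUnit_sub_of_nilpotent hn hz)⟩

/-- The identity `(A - z)⁻¹(A - w) = I + (z - w)(A - z)⁻¹` links the two kinds of representation:
replacing `Γ` by `(A - z₀) Γ` turns the resolvent field into the `γ`-field with base point `z₀`. -/
theorem res_sub_smul (hA : A = (T : V →ₗ[ℂ] V).graph) {z : ℂ} (hz : z ∈ rho A) (w : ℂ) (x : V) :
    res A z ((T - w • ContinuousLinearMap.id ℂ V) x) = transfer A w z x := by
  have h := res_apply hz (x := x) (y := T x) (by
    rw [hA]
    exact (LinearMap.mem_graph_iff _ _).2 rfl)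
  change res A z (T x - w • x) = x + (z - w) • res A z x
  rw [map_sub, map_smul] at h ⊢
  linear_combination (norm := module) h

end NilpotentGraph

/-! ### Functions with minimal representations -/

section Representations

variable {H : Type*} [NormedAddCommGroup H] [InnerProductSpace ℂ H] [CompleteSpace H]
  {V : Type*} [NormedAddCommGroup V] [InnerProductSpace ℂ V] [CompleteSpace V]
  {Q : ℂ → H →L[ℂ] H} {G : V →L[ℂ] V} {A : Submodule ℂ (V × V)} {Γ : H →L[ℂ] V} {κ : ℕ} {z₀ : ℂ}

theorem inner_kernel (hsymm : ∀ z ∈ domain Q, ContinuousLinearMap.adjoint (Q (conj z)) = Q z)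
    (z : ℂ) {w : ℂ} (hw : w ∈ domain Q) (g h : H) :
    inner ℂ h (kernel Q z w g) =
      (z - conj w)⁻¹ * (inner ℂ h (Q z g) - inner ℂ h (Q (conj w) g)) := by
  have h1 := hsymm _ (conj_mem_domain hsymm hw)
  rw [Complex.conj_conj] at h1
  simp [kernel, h1]

theorem sub_conj_ne_zero {z w : ℂ} (hz : 0 < z.im) (hw : 0 < w.im) : z - conj w ≠ 0 := by
  intro h
  have := congrArg Complex.im h
  simp at this
  linarith

theorem IsMinimalOperatorRepresentation.isGeneralizedNevanlinna
    (h : IsMinimalOperatorRepresentation κ Q G A Γ) (hmero : MeromorphicOn Q {z : ℂ | z.im ≠ 0})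
    (hsymm : ∀ z ∈ domain Q, ContinuousLinearMap.adjoint (Q (conj z)) = Q z) :
    IsGeneralizedNevanlinna κ Q := by
  have hρ := h.domain_subset
  refine isGeneralizedNevanlinna_of_minimal (γ := fun z => (res A z).comp Γ) hmero hsymm
    h.pontryagin h.selfAdjoint hρ (fun z hz w hw x => ?_) (fun z hz w hw hz' hw' g x => ?_)
    h.minimal
  · change res A w (Γ x) + (z - w) • res A z (res A w (Γ x)) = res A z (Γ x)
    rw [← res_sub_res hz hw, add_sub_cancel]
  · have hwc := conj_mem_domain hsymm hw
    rw [inner_kernel hsymm z hw, h.formula z hz, h.formula _ hwc]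
    simp only [ContinuousLinearMap.comp_apply, inner_plus]
    rw [← form_sub_right, res_sub_res (hρ hz) (hρ hwc), form_smul_right, ← mul_assoc,
      inv_mul_cancel₀ (sub_conj_ne_zero hz' hw'), one_mul, res_comm (hρ hz) (hρ hwc),
      form_res h.selfAdjoint (hρ hw) (hρ hwc)]

theorem IsMinimalRepresentation.isGeneralizedNevanlinna
    (h : IsMinimalRepresentation κ Q G A Γ z₀) (hmero : MeromorphicOn Q {z : ℂ | z.im ≠ 0})
    (hsymm : ∀ z ∈ domain Q, ContinuousLinearMap.adjoint (Q (conj z)) = Q z) :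
    IsGeneralizedNevanlinna κ Q := by
  have hρ := h.domain_subset
  refine isGeneralizedNevanlinna_of_minimal (γ := fun z => gammaField A Γ z₀ z) hmero hsymm
    h.pontryagin h.selfAdjoint hρ (fun z hz w hw x => transfer_trans hz hw z₀ (Γ x))
    (fun z hz w hw hz' hw' g x => ?_) h.minimal
  have hwc := conj_mem_domain hsymm hw
  -- The resolvent identity in the form needed for the kernel: its right-hand side, paired with `Γ
  -- x`, is the difference `Q(z) - Q(conj w)`.
  have key : (z - conj w) • transfer A (conj z₀) (conj w) (transfer A z₀ z (Γ g))
      = (z - conj z₀) • transfer A z₀ z (Γ g)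
        - (conj w - conj z₀) • transfer A z₀ (conj w) (Γ g) := by
    have h1 := res_sub_res (hρ hwc) (hρ hz) (Γ g)
    simp only [transfer_apply, map_add, map_smul]
    linear_combination (norm := module) ((conj w - conj z₀) * (z - z₀)) • h1
  rw [inner_kernel hsymm z hw, h.formula z hz, h.formula _ hwc]
  change _ = form G (transfer A z₀ w (Γ x)) (transfer A z₀ z (Γ g))
  rw [form_transfer h.selfAdjoint (hρ hw) (hρ hwc)]
  simp only [add_apply, smul_apply,
    ContinuousLinearMap.comp_apply, inner_add_right, inner_smul_right, inner_plus]
  change (z - conj w)⁻¹ * (_ + (z - conj z₀) * form G (Γ x) (transfer A z₀ z (Γ g))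
    - (_ + (conj w - conj z₀) * form G (Γ x) (transfer A z₀ (conj w) (Γ g)))) = _
  rw [add_sub_add_left_eq_sub, ← form_smul_right, ← form_smul_right, ← form_sub_right, ← key,
    form_smul_right, ← mul_assoc, inv_mul_cancel₀ (sub_conj_ne_zero hz' hw'), one_mul]

/-- Both minimality conditions enter the geometric decomposition only through cyclicity, so that
decomposition serves both kinds of representation. -/
theorem IsMinimalOperatorRepresentation.isCyclic
    (h : IsMinimalOperatorRepresentation κ Q G A Γ) : IsCyclic A Γ := by
  intro W hW hΓ hres
  rw [eq_top_iff, ← h.minimal]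
  refine Submodule.topologicalClosure_minimal _ (Submodule.span_le.2 ?_) hW
  rintro _ ⟨z, hz, x, rfl⟩
  exact hres z hz _ (hΓ x)

theorem IsMinimalRepresentation.isCyclic (h : IsMinimalRepresentation κ Q G A Γ z₀) :
    IsCyclic A Γ := by
  intro W hW hΓ hres
  rw [eq_top_iff, ← h.minimal]
  refine Submodule.topologicalClosure_minimal _ (Submodule.span_le.2 ?_) hW
  rintro _ ⟨z, hz, x, rfl⟩
  exact W.add_mem (hΓ x) (W.smul_mem _ (hres z hz _ (hΓ x)))

/-- The function `Γ⁺ (A - z)⁻¹ Γ`. -/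
noncomputable def weylFunction (G : V →L[ℂ] V) (A : Submodule ℂ (V × V)) (Γ : H →L[ℂ] V) (z : ℂ) :
    H →L[ℂ] H := (plus G Γ).comp ((res A z).comp Γ)

theorem adjoint_weylFunction (hG : ∀ x y, form G y x = conj (form G x y))
    (hA : IsSelfAdjointRel G A) {z : ℂ} (hz : z ∈ rho A) (hz' : conj z ∈ rho A) :
    ContinuousLinearMap.adjoint (weylFunction G A Γ (conj z)) = weylFunction G A Γ z := by
  ext x
  refine ext_inner_left ℂ fun y => ?_
  rw [ContinuousLinearMap.adjoint_inner_right, ← inner_conj_symm]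
  change conj (inner ℂ x (plus G Γ _)) = inner ℂ y (plus G Γ _)
  rw [inner_plus, inner_plus, ← hG]
  change form G (res A (conj z) (Γ y)) (Γ x) = form G (Γ y) (res A z (Γ x))
  rw [form_res hA hz' (by rwa [Complex.conj_conj]), Complex.conj_conj]

/-! ### Functions represented by operators with the single spectral point `α` -/

section Graph

variable {T : V →L[ℂ] V}

theorem analyticAt_weylFunction (hA : A = (T : V →ₗ[ℂ] V).graph) {μ : ℂ} {n : ℕ}
    (hn : (T - μ • ContinuousLinearMap.id ℂ V) ^ n = 0) {z : ℂ} (hz : z ≠ μ) :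
    AnalyticAt ℂ (weylFunction G A Γ) z := by
  have h1 : AnalyticAt ℂ (fun w : ℂ => T - w • (1 : V →L[ℂ] V)) z := by fun_prop
  obtain ⟨u, hu⟩ := isUnit_sub_of_nilpotent hn hz
  have h2 : AnalyticAt ℂ (fun w : ℂ => Ring.inverse (T - w • (1 : V →L[ℂ] V))) z := by
    have := analyticAt_inverse (𝕜 := ℂ) u
    rw [hu] at this
    exact AnalyticAt.comp (f := fun w : ℂ => T - w • (1 : V →L[ℂ] V)) (x := z) this h1
  have h3 : AnalyticAt ℂ (res A) z := by
    refine h2.congr ?_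
    filter_upwards [isOpen_ne.mem_nhds hz] with w hw
    exact (isResolventAt_graph hA (isUnit_sub_of_nilpotent hn hw)).res_eq.symm
  let L : (V →L[ℂ] V) →L[ℂ] (H →L[ℂ] H) :=
    (ContinuousLinearMap.compL ℂ H V H (plus G Γ)).comp
      ((ContinuousLinearMap.compL ℂ H V V).flip Γ)
  exact (L.analyticAt _).comp h3

variable {α : ℝ} {n : ℕ}

theorem ne_ofReal_of_im {z : ℂ} (hz : z.im ≠ 0) : z ≠ (α : ℂ) := by
  rintro rfl
  exact hz (Complex.ofReal_im α)

theorem domain_weylFunction (hA : A = (T : V →ₗ[ℂ] V).graph)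
    (hn : (T - (α : ℂ) • ContinuousLinearMap.id ℂ V) ^ n = 0) :
    domain (weylFunction G A Γ) = {z | z.im ≠ 0} :=
  Set.Subset.antisymm (fun _ hz => hz.1) fun _ hz =>
    ⟨hz, analyticAt_weylFunction hA hn (ne_ofReal_of_im hz)⟩

theorem adjoint_weylFunction_of_nilpotent (hG : ∀ x y, form G y x = conj (form G x y))
    (hsa : IsSelfAdjointRel G A) (hA : A = (T : V →ₗ[ℂ] V).graph)
    (hn : (T - (α : ℂ) • ContinuousLinearMap.id ℂ V) ^ n = 0) {z : ℂ} (hz : z.im ≠ 0) :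
    ContinuousLinearMap.adjoint (weylFunction G A Γ (conj z)) = weylFunction G A Γ z :=
  adjoint_weylFunction hG hsa (mem_rho_of_nilpotent hA hn (ne_ofReal_of_im hz))
    (mem_rho_of_nilpotent hA hn (ne_ofReal_of_im (by simpa using hz)))

theorem weylFunction_representation (hP : IsPontryagin G κ) (hsa : IsSelfAdjointRel G A)
    (hA : A = (T : V →ₗ[ℂ] V).graph)
    (hn : (T - (α : ℂ) • ContinuousLinearMap.id ℂ V) ^ n = 0)
    (hmin : (Submodule.span ℂ {v : V | ∃ z ∈ rho A, ∃ h : H,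
      v = res A z (Γ h)}).topologicalClosure = ⊤) :
    IsGeneralizedNevanlinna κ (weylFunction G A Γ) ∧
      IsMinimalOperatorRepresentation κ (weylFunction G A Γ) G A Γ := by
  have hrep : IsMinimalOperatorRepresentation κ (weylFunction G A Γ) G A Γ :=
    ⟨hP, hsa, ⟨T, hA⟩, fun z hz => mem_rho_of_nilpotent hA hn (ne_ofReal_of_im hz.1),
      fun _ _ => rfl, hmin⟩
  exact ⟨hrep.isGeneralizedNevanlinna
    (fun z hz => (analyticAt_weylFunction hA hn (ne_ofReal_of_im hz)).meromorphicAt)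
    fun z hz => adjoint_weylFunction_of_nilpotent hP.hermitian hsa hA hn hz.1, hrep⟩

/-- The representation of `Γ~⁺ (A - z)⁻¹ Γ~`, `Γ~ = (A - z₀) Γ`, with base point `z₀`. -/
theorem weylFunction_base_representation (hP : IsPontryagin G κ) (hsa : IsSelfAdjointRel G A)
    (hA : A = (T : V →ₗ[ℂ] V).graph)
    (hn : (T - (α : ℂ) • ContinuousLinearMap.id ℂ V) ^ n = 0) (hz₀ : 0 < z₀.im)
    (hmin : (Submodule.span ℂ {v : V | ∃ z ∈ rho A, ∃ h : H,
      v = gammaField A Γ z₀ z h}).topologicalClosure = ⊤) :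
    IsGeneralizedNevanlinna κ
        (weylFunction G A ((T - z₀ • ContinuousLinearMap.id ℂ V).comp Γ)) ∧
      IsMinimalRepresentation κ
        (weylFunction G A ((T - z₀ • ContinuousLinearMap.id ℂ V).comp Γ)) G A Γ z₀ ∧
      IsMinimalOperatorRepresentation κ
        (weylFunction G A ((T - z₀ • ContinuousLinearMap.id ℂ V).comp Γ)) G A
        ((T - z₀ • ContinuousLinearMap.id ℂ V).comp Γ) := by
  set Δ := (T - z₀ • ContinuousLinearMap.id ℂ V).comp Γ with hΔ
  have hΔres : ∀ z ∈ rho A, ∀ h, res A z (Δ h) = gammaField A Γ z₀ z h :=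
    fun z hz h => res_sub_smul hA hz z₀ (Γ h)
  have hset : {v : V | ∃ z ∈ rho A, ∃ h : H, v = res A z (Δ h)}
      = {v : V | ∃ z ∈ rho A, ∃ h : H, v = gammaField A Γ z₀ z h} := by
    ext v
    constructor
    · rintro ⟨z, hz, h, rfl⟩
      exact ⟨z, hz, h, hΔres z hz h⟩
    · rintro ⟨z, hz, h, rfl⟩
      exact ⟨z, hz, h, (hΔres z hz h).symm⟩
  obtain ⟨h1, h2⟩ := weylFunction_representation (Γ := Δ) hP hsa hA hn (by rw [hset]; exact hmin)
  have him : ∀ z : ℂ, z.im ≠ 0 → z ∈ rho A :=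
    fun z hz => mem_rho_of_nilpotent hA hn (ne_ofReal_of_im hz)
  have hb : z₀ ∈ domain (weylFunction G A Δ) := by
    rw [domain_weylFunction hA hn]
    exact hz₀.ne'
  refine ⟨h1, ⟨hP, hsa, hz₀, hb, h2.domain_subset, fun z hz => ?_, hmin⟩, h2⟩
  have hzρ := him z hz.1
  have h0ρ := him z₀ hz₀.ne'
  have h0ρ' := him (conj z₀) (by simpa using hz₀.ne')
  have h3 := adjoint_weylFunction_of_nilpotent (Γ := Δ) hP.hermitian hsa hA hn
    (z := conj z₀) (by simpa using hz₀.ne')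
  rw [Complex.conj_conj] at h3
  rw [h3]
  ext g
  refine ext_inner_left ℂ fun x => ?_
  simp only [add_apply, smul_apply,
    ContinuousLinearMap.comp_apply, inner_add_right, inner_smul_right, inner_plus, weylFunction]
  -- The resolvent identity for `z` and `conj z₀` produces two resolvents. The one at `z` absorbs `A
  -- - z₀` from the right-hand `Δ`; the one at `conj z₀` passes to the other side of the form and
  -- turns the left-hand `Δ` back into `Γ`.
  rw [← sub_eq_iff_eq_add', ← form_sub_right, res_sub_res hzρ h0ρ', form_smul_right,
    res_comm hzρ h0ρ', hΔres z hzρ, ← form_res hsa h0ρ h0ρ', hΔres z₀ h0ρ]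
  simp [gammaField]

end Graph

/-- Subtraction of a symmetric function which is holomorphic off the real line. -/
theorem sub_holomorphic {P : ℂ → H →L[ℂ] H} (hP : ∀ z : ℂ, z.im ≠ 0 → AnalyticAt ℂ P z)
    (hPs : ∀ z : ℂ, z.im ≠ 0 → ContinuousLinearMap.adjoint (P (conj z)) = P z)
    (hmero : MeromorphicOn Q {z : ℂ | z.im ≠ 0})
    (hsymm : ∀ z ∈ domain Q, ContinuousLinearMap.adjoint (Q (conj z)) = Q z) :
    domain (Q - P) = domain Q ∧ MeromorphicOn (Q - P) {z : ℂ | z.im ≠ 0} ∧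
      ∀ z ∈ domain (Q - P), ContinuousLinearMap.adjoint ((Q - P) (conj z)) = (Q - P) z := by
  have hd : domain (Q - P) = domain Q := by
    ext z
    constructor
    · rintro ⟨h1, h2⟩
      refine ⟨h1, ?_⟩
      have := h2.add (hP z h1)
      rwa [sub_add_cancel] at this
    · rintro ⟨h1, h2⟩
      exact ⟨h1, h2.sub (hP z h1)⟩
  refine ⟨hd, fun z hz => (hmero z hz).sub (hP z hz).meromorphicAt, fun z hz => ?_⟩
  rw [Pi.sub_apply, Pi.sub_apply, map_sub, hsymm z (hd ▸ hz), hPs z hz.1]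

theorem sum_symmetric {ι : Type*} [Fintype ι] {p : ι → ℂ → H →L[ℂ] H}
    (hp : ∀ i, ∀ z : ℂ, z.im ≠ 0 → AnalyticAt ℂ (p i) z)
    (hps : ∀ i, ∀ z : ℂ, z.im ≠ 0 → ContinuousLinearMap.adjoint (p i (conj z)) = p i z) :
    (∀ z : ℂ, z.im ≠ 0 → AnalyticAt ℂ (∑ i, p i) z) ∧
      ∀ z : ℂ, z.im ≠ 0 → ContinuousLinearMap.adjoint ((∑ i, p i) (conj z)) = (∑ i, p i) z := by
  refine ⟨fun z hz => Finset.analyticAt_sum _ fun i _ => hp i z hz, fun z hz => ?_⟩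
  rw [Finset.sum_apply, Finset.sum_apply, map_sum]
  exact Finset.sum_congr rfl fun i _ => hps i z hz

end Representations

/-! ### The decomposition of the function -/

section PartMinimal

variable {H : Type*} [NormedAddCommGroup H] [InnerProductSpace ℂ H]
  {K : Type*} [NormedAddCommGroup K] [InnerProductSpace ℂ K]
  {G : K →L[ℂ] K} {A : Submodule ℂ (K × K)} {Γ : H →L[ℂ] K} {z₀ : ℂ}

/-- The projection commutes with the resolvents and maps a dense span onto a dense one; passing to
the possibly larger resolvent set of the part only adds vectors. -/
theorem OrthProj.Reduces.minimal_res {E : OrthProj G} (hE : E.Reduces A)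
    (h : (Submodule.span ℂ {v : K | ∃ z ∈ rho A, ∃ h : H,
      v = res A z (Γ h)}).topologicalClosure = ⊤) :
    (Submodule.span ℂ {v : E.space | ∃ z ∈ rho (E.part A), ∃ h : H,
      v = res (E.part A) z (E.comp Γ h)}).topologicalClosure = ⊤ := by
  refine E.dense_span_proj h ?_
  rintro _ ⟨z, hz, x, rfl⟩
  exact ⟨z, hE.rho_subset hz, x, (hE.res_proj hz (Γ x)).symm⟩

theorem OrthProj.Reduces.minimal_gammaField {E : OrthProj G} (hE : E.Reduces A)
    (h : (Submodule.span ℂ {v : K | ∃ z ∈ rho A, ∃ h : H,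
      v = gammaField A Γ z₀ z h}).topologicalClosure = ⊤) :
    (Submodule.span ℂ {v : E.space | ∃ z ∈ rho (E.part A), ∃ h : H,
      v = gammaField (E.part A) (E.comp Γ) z₀ z h}).topologicalClosure = ⊤ := by
  refine E.dense_span_proj h ?_
  rintro _ ⟨z, hz, x, rfl⟩
  exact ⟨z, hE.rho_subset hz, x, (hE.transfer_proj hz z₀ (Γ x)).symm⟩

end PartMinimal

/-! ### From the decomposition of the space to that of the function -/

section FunctionDecomposition

variable {H : Type*} [NormedAddCommGroup H] [InnerProductSpace ℂ H] [CompleteSpace H]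
  {K : Type*} [NormedAddCommGroup K] [InnerProductSpace ℂ K] [CompleteSpace K]
  {Q : ℂ → H →L[ℂ] H} {G : K →L[ℂ] K} {A : Submodule ℂ (K × K)} {Γ : H →L[ℂ] K} {α : ℝ}
  {κ : ℕ} {z₀ : ℂ}

theorem OrthProj.plus_proj (E : OrthProj G) (x : K) :
    plus E.gram (E.comp Γ) (E.proj x) = plus G Γ (E.op x) := by
  refine ext_inner_left ℂ fun h => ?_
  rw [inner_plus, inner_plus, E.form_gram]
  change form G (E.op (Γ h)) (E.op x) = _
  rw [E.symm, E.idem]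

theorem sum_plus_proj {ι : Type*} [Fintype ι] {E : ι → OrthProj G}
    (hsum : ∑ i, (E i).op = ContinuousLinearMap.id ℂ K) (x : K) :
    ∑ i, plus (E i).gram ((E i).comp Γ) ((E i).proj x) = plus G Γ x := by
  simp only [OrthProj.plus_proj]
  rw [← map_sum, ← sum_apply, hsum]
  rfl

/-- The first `r + 1` functions come from nilpotent parts and are holomorphic off the real line.
Taking the last one as the difference `Q - P` gives it exactly the domain of `Q`, together with
meromorphy and symmetry; its formula holds since the terms `Γᵢ⁺(Aᵢ - z)⁻¹Γᵢ` add up to `Γ⁺(A -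
z)⁻¹Γ`. -/
theorem IsMinimalOperatorRepresentation.exists_decomposition
    (hQ : IsGeneralizedNevanlinna κ Q) (h : IsMinimalOperatorRepresentation κ Q G A Γ)
    {K₀ : Submodule ℂ K} (hK₀ : IsMaximalPositiveEigenspace G A α K₀) :
    ∃ (r : ℕ) (E : Fin (r + 2) → OrthProj G) (k : Fin (r + 2) → ℕ)
      (q : Fin (r + 2) → ℂ → H →L[ℂ] H),
      IsJordanDecomposition G A Γ α κ K₀ E k ∧
      (∀ i, IsGeneralizedNevanlinna (k i) (q i) ∧ domain Q ⊆ domain (q i) ∧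
        IsMinimalOperatorRepresentation (k i) (q i) (E i).gram ((E i).part A)
          ((E i).comp Γ)) ∧
      (∀ z ∈ domain Q, Q z = ∑ i, q i z) := by
  obtain ⟨r, E, k, hdec, hnil⟩ :=
    exists_isJordanDecomposition h.pontryagin h.selfAdjoint h.isCyclic hK₀
  choose T n hT hn using hnil
  have hred : ∀ i, (E i).Reduces A := hdec.reduces
  have hsa : ∀ i, IsSelfAdjointRel (E i).gram ((E i).part A) :=
    fun i => (hred i).isSelfAdjointRel h.selfAdjoint
  let p : Fin (r + 1) → ℂ → H →L[ℂ] H := fun j =>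
    weylFunction (E j.castSucc).gram ((E j.castSucc).part A) ((E j.castSucc).comp Γ)
  let P : ℂ → H →L[ℂ] H := ∑ j, p j
  have hp : ∀ j, ∀ z : ℂ, z.im ≠ 0 → AnalyticAt ℂ (p j) z := fun j z hz =>
    analyticAt_weylFunction (hT j) (hn j) (ne_ofReal_of_im hz)
  obtain ⟨hPa, hPs⟩ := sum_symmetric hp fun j z hz =>
    adjoint_weylFunction_of_nilpotent (hdec.pontryagin _).hermitian (hsa _) (hT j) (hn j) hz
  obtain ⟨hd, hmero, hsymm⟩ := sub_holomorphic hPa hPs hQ.meromorphic hQ.symmetric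
  set L := Fin.last (r + 1) with hL
  have hlast : IsMinimalOperatorRepresentation (k L) (Q - P) (E L).gram ((E L).part A)
      ((E L).comp Γ) := by
    obtain ⟨S, hS⟩ := h.bounded
    refine ⟨hdec.pontryagin L, hsa L, ⟨_, (hred L).part_graph hS⟩,
      hd ▸ h.domain_subset.trans (hred L).rho_subset, fun z hz => ?_,
      (hred L).minimal_res h.minimal⟩
    have hzQ : z ∈ domain Q := hd ▸ hz
    have hzρ := h.domain_subset hzQ
    ext x
    have h1 := sum_plus_proj (Γ := Γ) hdec.sum_eq (res A z (Γ x))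
    rw [Fin.sum_univ_castSucc] at h1
    simp only [← (hred _).res_proj hzρ] at h1
    have h2 : P z x = ∑ j : Fin (r + 1), plus (E j.castSucc).gram ((E j.castSucc).comp Γ)
        (res ((E j.castSucc).part A) z ((E j.castSucc).proj (Γ x))) := by
      rw [show P z = ∑ j, p j z from Finset.sum_apply _ _ _, sum_apply]
      rfl
    change Q z x - P z x = _
    rw [h.formula z hzQ, h2, sub_eq_iff_eq_add']
    exact h1.symm
  refine ⟨r, E, k, Fin.snoc (α := fun _ => ℂ → H →L[ℂ] H) p (Q - P), hdec, ?_, fun z _ => ?_⟩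
  · refine Fin.lastCases ?_ fun j => ?_
    · rw [Fin.snoc_last]
      exact ⟨hlast.isGeneralizedNevanlinna hmero hsymm, hd.ge, hlast⟩
    · rw [Fin.snoc_castSucc]
      obtain ⟨h1, h2⟩ := weylFunction_representation (hdec.pontryagin _) (hsa _) (hT j) (hn j)
        ((hred _).minimal_res h.minimal)
      exact ⟨h1, fun z hz => ⟨hz.1, hp j z hz.1⟩, h2⟩
  · rw [Fin.sum_univ_castSucc]
    simp only [Fin.snoc_last, Fin.snoc_castSucc]
    rw [Pi.sub_apply, show P z = ∑ j, p j z from Finset.sum_apply _ _ _, add_sub_cancel]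

/-- A representation with base point fixes its function only up to a selfadjoint constant. On the
nilpotent parts the constant is chosen so that the function is `Γ~⁺(A - z)⁻¹Γ~` with `Γ~ = (A -
z₀)Γ`; the rest of the constant goes to the last function, defined as the difference. -/
theorem IsMinimalRepresentation.exists_decomposition
    (hQ : IsGeneralizedNevanlinna κ Q) (h : IsMinimalRepresentation κ Q G A Γ z₀)
    {K₀ : Submodule ℂ K} (hK₀ : IsMaximalPositiveEigenspace G A α K₀) :
    ∃ (r : ℕ) (E : Fin (r + 2) → OrthProj G) (k : Fin (r + 2) → ℕ)
      (q : Fin (r + 2) → ℂ → H →L[ℂ] H),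
      IsJordanDecomposition G A Γ α κ K₀ E k ∧
      (∀ i, IsGeneralizedNevanlinna (k i) (q i) ∧ domain Q ⊆ domain (q i) ∧
        IsMinimalRepresentation (k i) (q i) (E i).gram ((E i).part A) ((E i).comp Γ) z₀) ∧
      (∀ z ∈ domain Q, Q z = ∑ i, q i z) ∧
      ∀ j : Fin (r + 1), ∃ T : (E j.castSucc).space →L[ℂ] (E j.castSucc).space,
        (E j.castSucc).part A =
          (T : (E j.castSucc).space →ₗ[ℂ] (E j.castSucc).space).graph ∧
        IsMinimalOperatorRepresentation (k j.castSucc) (q j.castSucc) (E j.castSucc).gram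
          ((E j.castSucc).part A)
          ((T - z₀ • ContinuousLinearMap.id ℂ (E j.castSucc).space).comp
            ((E j.castSucc).comp Γ)) := by
  obtain ⟨r, E, k, hdec, hnil⟩ :=
    exists_isJordanDecomposition h.pontryagin h.selfAdjoint h.isCyclic hK₀
  choose T n hT hn using hnil
  have hred : ∀ i, (E i).Reduces A := hdec.reduces
  have hsa : ∀ i, IsSelfAdjointRel (E i).gram ((E i).part A) :=
    fun i => (hred i).isSelfAdjointRel h.selfAdjoint
  let p : Fin (r + 1) → ℂ → H →L[ℂ] H := fun j =>
    weylFunction (E j.castSucc).gram ((E j.castSucc).part A)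
      ((T j - z₀ • ContinuousLinearMap.id ℂ (E j.castSucc).space).comp ((E j.castSucc).comp Γ))
  have hrep := fun j : Fin (r + 1) => weylFunction_base_representation
    (hdec.pontryagin j.castSucc) (hsa _) (hT j) (hn j) h.upper
    ((hred _).minimal_gammaField h.minimal)
  let P : ℂ → H →L[ℂ] H := ∑ j, p j
  have hPz : ∀ z, P z = ∑ j, p j z := fun z => Finset.sum_apply _ _ _
  have hp : ∀ j, ∀ z : ℂ, z.im ≠ 0 → AnalyticAt ℂ (p j) z := fun j z hz =>
    analyticAt_weylFunction (hT j) (hn j) (ne_ofReal_of_im hz)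
  obtain ⟨hPa, hPs⟩ := sum_symmetric hp fun j z hz =>
    adjoint_weylFunction_of_nilpotent (hdec.pontryagin _).hermitian (hsa _) (hT j) (hn j) hz
  obtain ⟨hd, hmero, hsymm⟩ := sub_holomorphic hPa hPs hQ.meromorphic hQ.symmetric
  set L := Fin.last (r + 1) with hL
  have hlast : IsMinimalRepresentation (k L) (Q - P) (E L).gram ((E L).part A)
      ((E L).comp Γ) z₀ := by
    refine ⟨hdec.pontryagin L, hsa L, h.upper, hd ▸ h.base,
      hd ▸ h.domain_subset.trans (hred L).rho_subset, fun z hz => ?_,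
      (hred L).minimal_gammaField h.minimal⟩
    have hzQ : z ∈ domain Q := hd ▸ hz
    have hzρ := h.domain_subset hzQ
    have hj : ∀ j, p j z = ContinuousLinearMap.adjoint (p j z₀) + (z - conj z₀) •
        (plus (E j.castSucc).gram ((E j.castSucc).comp Γ)).comp
          (gammaField ((E j.castSucc).part A) ((E j.castSucc).comp Γ) z₀ z) := fun j =>
      (hrep j).2.1.formula z ⟨hz.1, hp j z hz.1⟩
    have h1 : (plus G Γ).comp (gammaField A Γ z₀ z)
        = (∑ j : Fin (r + 1), (plus (E j.castSucc).gram ((E j.castSucc).comp Γ)).comp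
            (gammaField ((E j.castSucc).part A) ((E j.castSucc).comp Γ) z₀ z))
          + (plus (E L).gram ((E L).comp Γ)).comp
            (gammaField ((E L).part A) ((E L).comp Γ) z₀ z) := by
      ext x
      have h2 := sum_plus_proj (Γ := Γ) hdec.sum_eq (transfer A z₀ z (Γ x))
      rw [Fin.sum_univ_castSucc] at h2
      simp only [← (hred _).transfer_proj hzρ] at h2
      rw [add_apply, sum_apply]
      exact h2.symm
    rw [Pi.sub_apply, Pi.sub_apply, h.formula z hzQ, h1, hPz, hPz, map_sub, map_sum,
      Finset.sum_congr rfl fun j _ => hj j, Finset.sum_add_distrib, ← Finset.smul_sum, smul_add]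
    abel
  refine ⟨r, E, k, Fin.snoc (α := fun _ => ℂ → H →L[ℂ] H) p (Q - P), hdec, ?_, fun z _ => ?_,
    fun j => ⟨T j, hT j, ?_⟩⟩
  · refine Fin.lastCases ?_ fun j => ?_
    · rw [Fin.snoc_last]
      exact ⟨hlast.isGeneralizedNevanlinna hmero hsymm, hd.ge, hlast⟩
    · rw [Fin.snoc_castSucc]
      exact ⟨(hrep j).1, fun z hz => ⟨hz.1, hp j z hz.1⟩, (hrep j).2.1⟩
  · rw [Fin.sum_univ_castSucc]
    simp only [Fin.snoc_last, Fin.snoc_castSucc]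
    rw [Pi.sub_apply, hPz, add_sub_cancel]
  · rw [Fin.snoc_castSucc]
    exact (hrep j).2.2

end FunctionDecomposition

end GenNev

theorem proposition4 {H : Type*} [NormedAddCommGroup H] [InnerProductSpace ℂ H] [CompleteSpace H]
    {K : Type*} [NormedAddCommGroup K] [InnerProductSpace ℂ K] [CompleteSpace K]
    (κ κ' : ℕ) (Q : ℂ → H →L[ℂ] H) (hQ : IsGeneralizedNevanlinna κ Q)
    (G : K →L[ℂ] K) (A : Submodule ℂ (K × K)) (Γ : H →L[ℂ] K) (α : ℝ)
    (hα : IsPoleNotOfPositiveType G A α) :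
    -- `Q(z) = Q(z₀)* + (z - conj z₀) Γ⁺ (I + (z - z₀)(A - z)⁻¹) Γ`, `A` a self-adjoint relation
    (∀ z₀ : ℂ, IsMinimalRepresentation κ' Q G A Γ z₀ →
      (∃ K₀ : Submodule ℂ K, IsMaximalPositiveEigenspace G A α K₀) ∧
      ∀ K₀ : Submodule ℂ K, IsMaximalPositiveEigenspace G A α K₀ →
        ∃ (r : ℕ) (E : Fin (r + 2) → OrthProj G) (k : Fin (r + 2) → ℕ)
          (q : Fin (r + 2) → ℂ → H →L[ℂ] H),
          IsJordanDecomposition G A Γ α κ K₀ E k ∧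
          (∀ i, IsGeneralizedNevanlinna (k i) (q i) ∧ domain Q ⊆ domain (q i) ∧
            IsMinimalRepresentation (k i) (q i) (E i).gram ((E i).part A) ((E i).comp Γ) z₀) ∧
          (∀ z ∈ domain Q, Q z = ∑ i, q i z) ∧
          ∀ j : Fin (r + 1), ∃ T : (E j.castSucc).space →L[ℂ] (E j.castSucc).space,
            (E j.castSucc).part A =
              (T : (E j.castSucc).space →ₗ[ℂ] (E j.castSucc).space).graph ∧
            IsMinimalOperatorRepresentation (k j.castSucc) (q j.castSucc) (E j.castSucc).gram
              ((E j.castSucc).part A)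
              ((T - z₀ • ContinuousLinearMap.id ℂ (E j.castSucc).space).comp
                ((E j.castSucc).comp Γ))) ∧
    -- `Q(z) = Γ⁺ (A - z)⁻¹ Γ`, `A` a bounded self-adjoint operator
    (IsMinimalOperatorRepresentation κ' Q G A Γ →
      (∃ K₀ : Submodule ℂ K, IsMaximalPositiveEigenspace G A α K₀) ∧
      ∀ K₀ : Submodule ℂ K, IsMaximalPositiveEigenspace G A α K₀ →
        ∃ (r : ℕ) (E : Fin (r + 2) → OrthProj G) (k : Fin (r + 2) → ℕ)
          (q : Fin (r + 2) → ℂ → H →L[ℂ] H),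
          IsJordanDecomposition G A Γ α κ K₀ E k ∧
          (∀ i, IsGeneralizedNevanlinna (k i) (q i) ∧ domain Q ⊆ domain (q i) ∧
            IsMinimalOperatorRepresentation (k i) (q i) (E i).gram ((E i).part A)
              ((E i).comp Γ)) ∧
          (∀ z ∈ domain Q, Q z = ∑ i, q i z)) := by
  refine ⟨fun z₀ h => ?_, fun h => ?_⟩
  -- The representation puts `Q` into the class of index `κ'`, and the index of a function is
  -- unique, so the space has index `κ`.
  · obtain rfl := (h.isGeneralizedNevanlinna hQ.meromorphic hQ.symmetric).index_unique hQ
    exact ⟨exists_isMaximalPositiveEigenspace h.pontryagin h.selfAdjoint,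
      fun K₀ hK₀ => h.exists_decomposition hQ hK₀⟩
  · obtain rfl := (h.isGeneralizedNevanlinna hQ.meromorphic hQ.symmetric).index_unique hQ
    exact ⟨exists_isMaximalPositiveEigenspace h.pontryagin h.selfAdjoint,
      fun K₀ hK₀ => h.exists_decomposition hQ hK₀⟩
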